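/- **Setting.** $N$ items are to be permuted by a processor with a small private memory that reads and writes arrays in untrusted (encrypted) memory; an observer sees the sequence of accesses to untrusted memory with their addresses, but not the contents. A shuffle is *oblivious* if, for each $N$, there is a fixed access sequence $T$ that every successful run on every input produces and of which every failing (aborted) run produces an initial segment, and if moreover the distribution of the access sequence is the same for all inputs. Its *private memory* is the largest number of words (one word for each stored item, dummy or bucket index, plus list lengths and $O(1)$ counters) in use at any time of a run, over all inputs and all random choices. **Stash Shuffle** with parameters $B,D,C,S,K,W,Q$, where $BD\ge N$. The input and output arrays are divided into $B$ consecutive buckets of at most $D$ items. The intermediate array has $B$ buckets of $CB+K$ cells. *Distribution.* For each input bucket in turn: draw for each of its slots an independent uniform target in $\{0,\dots,B-1\}$; for each target $j$ move up to $C$ items from the part of the stash belonging to $j$ into an output chunk of capacity $C$ for $j$; read the items of the bucket one by one and put each into the chunk of its target if that is not full, otherwise into the stash (fail if the stash already holds $S$ items); pad all chunks with dummies to length $C$ and write them to the intermediate buckets. Then drain the stash: write to each intermediate bucket $j$ up to $K$ items from the part of the stash belonging to $j$, padded with dummies to length $K$; fail if the stash is not empty. *Compression.* To import an intermediate bucket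 means to load it, to permute it uniformly at random, and to append its non-dummy items to a queue of capacity $WD+Q$ (fail on overflow). To drain an output bucket means to write its (at most $D$) items from the front of the queue (fail on underflow). With $L=\min(W,B)$: import the buckets $0,\dots,L-1$; for $b=L,\dots,B-1$ drain bucket $b-L$ and then import bucket $b$; finally drain the buckets $B-L,\dots,B-1$. **Statement.** There is an oblivious shuffle on $N$ items that uses $N^{1/2+o(1)}$ private memory and whose output distribution is at statistical distance $N^{-\omega(1)}$ from uniform. More precisely, let $\varepsilon=\varepsilon(N)$ be any sequence, eventually positive, with $\ln\ln N/\ln N\ll\varepsilon\ll1$ as $N\to\infty$ (such sequences exist), and run the Stash Shuffle with $$B=\lceil N^{1/2-\varepsilon}\rceil,\quad D=\lceil N/B\rceil,\quad C=\lceil(1+\varepsilon)N^{2\varepsilon}\rceil,\quad S=\lceil N^{1/2+2\varepsilon}\rceil,\quad K=\lceil N^{3\varepsilon}\rceil,\quad W=2,\quad Q=\lceil N^{1/2+\varepsilon}\rceil .$$ Then the shuffle is oblivious for every $N$; its private memory is $N^{1/2+o(1)}$; and there is $g(N)\to\infty$ such that for all large $N$ and every initial arrangement of $N$ distinct items, the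 statistical distance between the distribution of its output (where a failing run outputs a special symbol) and the uniform distribution on the $N!$ arrangements is at most $N^{-g(N)}$. -/

import Mathlib

open Filter Topology Asymptotics

namespace StashShuffle

/-- Parameters of the Stash Shuffle: `B` buckets of at most `D` items, at most `C` items travelling
from an input bucket to an output bucket, a stash of total capacity `S`, `K` extra items per output
bucket for the final stash drain, window size `W`, queue slack `Q`. -/
structure Params where
  B : ℕ
  D : ℕ
  C : ℕ
  S : ℕ
  K : ℕ
  W : ℕ
  Q : ℕ

/-- Size of one bucket of the intermediate array. -/
def Params.midSize (p : Params) : ℕ := p.C * p.B + p.K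

/-- All random choices of one run: for every input bucket, the target bucket of each of its `D`
slots; for every intermediate bucket, the permutation with which it is shuffled. A run samples them
uniformly, so all targets are independent and uniform, as are all the permutations. -/
structure Coins (p : Params) where
  targets : Fin p.B → Fin p.D → Fin p.B
  perms : Fin p.B → Equiv.Perm (Fin p.midSize)

def coinsEquiv (p : Params) :
    Coins p ≃ (Fin p.B → Fin p.D → Fin p.B) × (Fin p.B → Equiv.Perm (Fin p.midSize)) where
  toFun ω := (ω.targets, ω.perms)
  invFun t := ⟨t.1, t.2⟩
  left_inv _ := rfl
  right_inv _ := rfl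

instance (p : Params) : Fintype (Coins p) := Fintype.ofEquiv _ (coinsEquiv p).symm

instance (p : Params) : Nonempty (Coins p) := ⟨⟨fun b _ => b, fun _ => 1⟩⟩

/-- What an observer of the untrusted memory sees: the accesses and their addresses. The contents
of the untrusted memory are encrypted and reveal nothing. -/
inductive Access where
  | readIn (i : ℕ)
  | writeMid (bucket i : ℕ)
  | readMid (bucket i : ℕ)
  | writeOut (i : ℕ)

/-- The private memory. Items have type `α`; in `Option α`, `none` is a dummy item. -/
structure Private (p : Params) (α : Type) where
  /-- the stash, organised by target bucket -/
  stash : Fin p.B → List α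
  /-- the output chunks being assembled, one for each target bucket -/
  chunk : Fin p.B → List (Option α)
  /-- the target buckets of the current input bucket -/
  targets : List (Fin p.B)
  /-- the freshly loaded intermediate bucket -/
  bucket : List (Option α)
  /-- the items waiting to be exported -/
  queue : List α

def Private.empty (p : Params) (α : Type) : Private p α := ⟨fun _ => [], fun _ => [], [], [], []⟩

/-- Number of items in the stash. -/
def Private.stashSize {p : Params} {α : Type} (m : Private p α) : ℕ := ∑ j, (m.stash j).length

/-- Amount of private memory in use, in words: one word for each stored item, dummy or target, one
word for the length of each list, and four words for loop counters and the current item. -/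
def Private.words {p : Params} {α : Type} (m : Private p α) : ℕ :=
  ∑ j, ((m.stash j).length + 1) + ∑ j, ((m.chunk j).length + 1) +
    (m.targets.length + 1) + (m.bucket.length + 1) + (m.queue.length + 1) + 4

/-- State of a run: the untrusted arrays, the accesses to them so far, the private memory, and the
largest amount of private memory used so far. -/
structure State (p : Params) (N : ℕ) (α : Type) where
  inp : Fin N → α
  mid : Fin p.B → ℕ → Option α
  out : Fin N → Option α
  trace : List Access
  priv : Private p α
  peak : ℕ

/-- Procedures; `failure` is FAIL, which aborts the run and keeps the state reached. -/
abbrev Proc (p : Params) (N : ℕ) (α : Type) : Type → Type := OptionT (StateM (State p N α))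

section Procedures

variable {p : Params} {N : ℕ} {α : Type}

/-! Primitive operations. -/

/-- A change of the private memory. -/
def privately (f : Private p α → Private p α) : Proc p N α Unit :=
  modify fun s => { s with priv := f s.priv, peak := max s.peak (f s.priv).words }

def getPrivate : Proc p N α (Private p α) := do return (← get).priv

def readIn (i : Fin N) : Proc p N α α := do
  modify fun s => { s with trace := s.trace ++ [Access.readIn i] }
  return (← get).inp i

def writeMid (j : Fin p.B) (i : ℕ) (x : Option α) : Proc p N α Unit :=
  modify fun s => { s with
    mid := Function.update s.mid j (Function.update (s.mid j) i x)
    trace := s.trace ++ [Access.writeMid j i] }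

def readMid (j : Fin p.B) (i : ℕ) : Proc p N α (Option α) := do
  modify fun s => { s with trace := s.trace ++ [Access.readMid j i] }
  return (← get).mid j i

def writeOut (i : Fin N) (a : α) : Proc p N α Unit :=
  modify fun s => { s with
    out := Function.update s.out i (some a)
    trace := s.trace ++ [Access.writeOut i] }

/-! Distribution phase. -/

/-- Move items from the stash into empty output chunks of capacity `cap`. -/
def unstash (cap : ℕ) : Proc p N α Unit :=
  privately fun m => { m with
    chunk := fun j => ((m.stash j).take cap).map some
    stash := fun j => (m.stash j).drop cap }

/-- Put the item of slot `i` into the output chunk of its target, or into the stash. -/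
def place (i : ℕ) (a : α) : Proc p N α Unit := do
  let m ← getPrivate
  let some t := m.targets[i]? | failure
  if (m.chunk t).length < p.C then
    privately fun m => { m with chunk := Function.update m.chunk t (m.chunk t ++ [some a]) }
  else if m.stashSize < p.S then
    privately fun m => { m with stash := Function.update m.stash t (m.stash t ++ [a]) }
  else
    failure

/-- Pad each output chunk with dummies to length `cap` and write it into the intermediate bucket of
its target, from position `off` on. -/
def flush (cap off : ℕ) : Proc p N α Unit := do
  privately fun m => { m with
    targets := []
    chunk := fun j => m.chunk j ++ List.replicate (cap - (m.chunk j).length) none }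
  (List.finRange p.B).forM fun j =>
    (List.range cap).forM fun i => do
      let m ← getPrivate
      writeMid j (off + i) ((m.chunk j).getD i none)
  privately fun m => { m with chunk := fun _ => [] }

/-- Distribute input bucket `b`, which consists of the positions `b * D + i < N` with `i < D`. -/
def distributeBucket (ω : Coins p) (b : Fin p.B) : Proc p N α Unit := do
  privately fun m => { m with targets := List.ofFn (ω.targets b) }
  unstash p.C
  (List.range p.D).forM fun i =>
    if h : b * p.D + i < N then do
      let a ← readIn ⟨b * p.D + i, h⟩
      place i a
    else
      pure ()
  flush p.C (b * p.C)

def drainStash : Proc p N α Unit := do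
  unstash p.K
  flush p.K (p.C * p.B)

/-! Compression phase. -/

/-- The queue has capacity `W * D + Q`; overflow is a failure. -/
def enqueue (a : α) : Proc p N α Unit := do
  let m ← getPrivate
  if m.queue.length < p.W * p.D + p.Q then
    privately fun m => { m with queue := m.queue ++ [a] }
  else
    failure

/-- Underflow of the queue is a failure. -/
def dequeue : Proc p N α α := do
  let m ← getPrivate
  match m.queue with
  | [] => failure
  | a :: q =>
    privately fun m => { m with queue := q }
    return a

/-- Load intermediate bucket `b`, shuffle it, and enqueue the items that are not dummies. -/
def importIntermediate (ω : Coins p) (b : Fin p.B) : Proc p N α Unit := do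
  (List.range p.midSize).forM fun i => do
    let x ← readMid b i
    privately fun m => { m with bucket := m.bucket ++ [x] }
  privately fun m => { m with
    bucket := List.ofFn fun i : Fin p.midSize => m.bucket.getD (ω.perms b i) none }
  let m ← getPrivate
  m.bucket.forM fun x =>
    match x with
    | none => pure ()
    | some a => enqueue a
  privately fun m => { m with bucket := [] }

/-- Export output bucket `b`, which consists of the positions `b * D + i < N` with `i < D`. -/
def drainQueue (b : ℕ) : Proc p N α Unit :=
  (List.range p.D).forM fun i =>
    if h : b * p.D + i < N then do
      let a ← dequeue
      writeOut ⟨b * p.D + i, h⟩ a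
    else
      pure ()

def compress (ω : Coins p) : Proc p N α Unit := do
  let L := min p.W p.B
  ((List.finRange p.B).take L).forM fun b => importIntermediate ω b
  ((List.finRange p.B).drop L).forM fun b => do
    drainQueue (b - L)
    importIntermediate ω b
  ((List.finRange p.B).drop (p.B - L)).forM fun b => drainQueue b

/-- The Stash Shuffle. -/
def stashShuffle (ω : Coins p) : Proc p N α Unit := do
  (List.finRange p.B).forM fun b => distributeBucket ω b
  drainStash
  let m ← getPrivate
  if m.stashSize = 0 then compress ω else failure

end Procedures

def initialState (p : Params) {N : ℕ} {α : Type} (x : Fin N → α) : State p N α where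
  inp := x
  mid := fun _ _ => none
  out := fun _ => none
  trace := []
  priv := Private.empty p α
  peak := (Private.empty p α).words

/-- The run on input `x` with random choices `ω`: `none` if it failed, and the final state. -/
def run {p : Params} {N : ℕ} {α : Type} (x : Fin N → α) (ω : Coins p) :
    Option Unit × State p N α :=
  (stashShuffle ω).run.run (initialState p x)

/-- The output array, or `none` if the run failed. -/
def output {p : Params} {N : ℕ} {α : Type} (x : Fin N → α) (ω : Coins p) :
    Option (Fin N → Option α) :=
  (run x ω).1.map fun _ => (run x ω).2.out

/-- The sequence of accesses to untrusted memory. -/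
def trace {p : Params} {N : ℕ} {α : Type} (x : Fin N → α) (ω : Coins p) : List Access :=
  (run x ω).2.trace

/-- The largest amount of private memory, in words, in use at any time of the run. -/
def peakMemory {p : Params} {N : ℕ} {α : Type} (x : Fin N → α) (ω : Coins p) : ℕ :=
  (run x ω).2.peak

/-- Private memory needed for `N` items: worst case over inputs and random choices, including
failing runs. (`N` items carry at most `N` different labels.) -/
def privateMemory (p : Params) (N : ℕ) : ℕ :=
  Finset.univ.sup fun xω : (Fin N → Fin N) × Coins p => peakMemory xω.1 xω.2

/-- Obliviousness: there is one fixed access sequence `T` that every successful run on every input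
produces, and of which every failing run produces an initial segment; and the distribution of the
access sequence does not depend on the input. -/
def Oblivious (p : Params) (N : ℕ) : Prop :=
  (∃ T : List Access, ∀ (α : Type) (x : Fin N → α) (ω : Coins p),
    trace x ω <+: T ∧ ((output x ω).isSome → trace x ω = T)) ∧
  ∀ (α : Type) (x y : Fin N → α),
    (PMF.uniformOfFintype (Coins p)).map (trace x) = (PMF.uniformOfFintype (Coins p)).map (trace y)

/-- Distribution of the output on input `x`; a failing run outputs the symbol `none`. -/
noncomputable def outputLaw (p : Params) {N : ℕ} (x : Fin N → Fin N) :
    PMF (Option (Fin N → Option (Fin N))) :=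
  (PMF.uniformOfFintype (Coins p)).map (output x)

/-- The uniform distribution on the permutations (arrangements) of the `N` items. -/
noncomputable def uniformLaw (N : ℕ) : PMF (Option (Fin N → Option (Fin N))) :=
  (PMF.uniformOfFintype (Equiv.Perm (Fin N))).map fun π => some fun i => some (π i)

/-- Statistical (total variation) distance. -/
noncomputable def statDist {Ω : Type} [Fintype Ω] (P Q : PMF Ω) : ℝ :=
  (1 / 2) * ∑ a, |(P a).toReal - (Q a).toReal|

/-- The instance for `N` items with exponent `ε`. -/
noncomputable def params (N : ℕ) (ε : ℝ) : Params where
  B := ⌈(N : ℝ) ^ (1 / 2 - ε)⌉₊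
  D := ⌈(N : ℝ) / ⌈(N : ℝ) ^ (1 / 2 - ε)⌉₊⌉₊
  C := ⌈(1 + ε) * (N : ℝ) ^ (2 * ε)⌉₊
  S := ⌈(N : ℝ) ^ (1 / 2 + 2 * ε)⌉₊
  K := ⌈(N : ℝ) ^ (3 * ε)⌉₊
  W := 2
  Q := ⌈(N : ℝ) ^ (1 / 2 + ε)⌉₊

/-- `ln ln N / ln N ≪ ε ≪ 1`, with `ε` positive. -/
def Admissible (ε : ℕ → ℝ) : Prop :=
  (∀ᶠ N in atTop, 0 < ε N) ∧ Tendsto ε atTop (𝓝 0) ∧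
    (fun N : ℕ => Real.log (Real.log N) / Real.log N) =o[atTop] ε

end StashShuffle

/-!
The control flow looks only at the positions, targets and lengths of the stored data, never at the
items. Relabelling the items therefore commutes with every procedure, and a single access sequence
serves all runs; an aborted run has performed a prefix of it.

For the distance from uniform, let `v` send every item to its intermediate bucket, and call `v` good
if no part of the stash ever needs more than `κ` places and the queue neither overflows nor
underflows. For good `v` the run succeeds whatever the permutations of the buckets are, and it
outputs the contents of the buckets one after the other. A given arrangement of the items can then
only arise if `v` is monotone along it, and for such `v` with `f j` items in bucket `j` it arises
with probability at most `∏ j, 1 / (f j)!`. As a monotone `v` is determined by `f`, the multinomial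
theorem bounds the probability of the arrangement by `1 / N!`. Hence the distance from uniform is at
most the probability that `v` is not good. Over-full parts of the stash are over-full windows of
consecutive input buckets, and the filling of the queue is governed by the number of items sent to
the first `b` buckets, so Chernoff bounds and a union bound show that this probability is at most
`N ^ 4 * exp (-N ^ (2 * ε) / 64)`.
-/

namespace StashShuffle

/-! ### Semantics of procedures -/

section Semantics

variable {p : Params} {N : ℕ} {α β γ : Type}

/-- Running a procedure from the state `s`: its result (`none` on failure) and the state reached. -/
def exec (x : Proc p N α β) (s : State p N α) : Option β × State p N α := x.run.run s

@[simp] theorem exec_failure (s : State p N α) :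
    exec (failure : Proc p N α β) s = (none, s) := rfl

theorem exec_bind (x : Proc p N α β) (k : β → Proc p N α γ) (s : State p N α) :
    exec (x >>= k) s =
      match exec x s with
      | (some a, s') => exec (k a) s'
      | (none, s') => (none, s') := by
  have unfolded : exec (x >>= k) s = (match exec x s with
      | (o, s') => (match o with
        | some a => (k a).run
        | none => pure none : StateM (State p N α) (Option γ)).run s') := rfl
  rw [unfolded]
  rcases exec x s with ⟨_ | a, s'⟩ <;> rfl

theorem exec_bind_of_some {x : Proc p N α β} {k : β → Proc p N α γ} {s s' : State p N α} {a : β}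
    (h : exec x s = (some a, s')) : exec (x >>= k) s = exec (k a) s' := by
  rw [exec_bind, h]

theorem exec_bind_of_none {x : Proc p N α β} {k : β → Proc p N α γ} {s s' : State p N α}
    (h : exec x s = (none, s')) : exec (x >>= k) s = (none, s') := by
  rw [exec_bind, h]

@[simp] theorem exec_privately (f : Private p α → Private p α) (s : State p N α) :
    exec (privately f) s =
      (some (), { s with priv := f s.priv, peak := max s.peak (f s.priv).words }) := rfl

@[simp] theorem exec_getPrivate (s : State p N α) :
    exec (getPrivate : Proc p N α _) s = (some s.priv, s) := rfl

@[simp] theorem exec_readMid (j : Fin p.B) (i : ℕ) (s : State p N α) :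
    exec (readMid j i) s =
      (some (s.mid j i), { s with trace := s.trace ++ [Access.readMid j i] }) := rfl

@[simp] theorem exec_writeMid (j : Fin p.B) (i : ℕ) (x : Option α) (s : State p N α) :
    exec (writeMid j i x) s = (some (), { s with
      mid := Function.update s.mid j (Function.update (s.mid j) i x)
      trace := s.trace ++ [Access.writeMid j i] }) := rfl

@[simp] theorem exec_writeOut (i : Fin N) (a : α) (s : State p N α) :
    exec (writeOut i a) s = (some (), { s with
      out := Function.update s.out i (some a)
      trace := s.trace ++ [Access.writeOut i] }) := rfl

end Semantics

/-! ### Relabelling the items -/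

section Relabelling

variable {p : Params} {N : ℕ} {α α' β β' γ γ' : Type}

/-- The private memory after replacing each item `a` by `f a`. -/
def Private.map (f : α → α') (m : Private p α) : Private p α' where
  stash j := (m.stash j).map f
  chunk j := (m.chunk j).map (Option.map f)
  targets := m.targets
  bucket := m.bucket.map (Option.map f)
  queue := m.queue.map f

@[simp] theorem Private.stashSize_map (f : α → α') (m : Private p α) :
    (m.map f).stashSize = m.stashSize := by
  simp [Private.stashSize, Private.map]

@[simp] theorem Private.words_map (f : α → α') (m : Private p α) :
    (m.map f).words = m.words := by
  simp [Private.words, Private.map]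

/-- The state after replacing each item `a` by `f a`. -/
def State.map (f : α → α') (s : State p N α) : State p N α' where
  inp i := f (s.inp i)
  mid j i := (s.mid j i).map f
  out i := (s.out i).map f
  trace := s.trace
  priv := s.priv.map f
  peak := s.peak

theorem initialState_map (x : Fin N → α) (f : α → α') :
    (initialState p x).map f = initialState p (f ∘ x) := by
  have priv_eq : (Private.empty p α).map f = Private.empty p α' := rfl
  simp only [initialState, State.map, State.mk.injEq, Option.map_none, Function.comp_def, true_and]
  exact ⟨priv_eq, by rw [← priv_eq, Private.words_map]⟩

/-- Parametricity: `y` does on items relabelled by `f` what `x` does on the original items, the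
results being related by `g`. -/
def Relabels (f : α → α') (g : β → β') (x : Proc p N α β) (y : Proc p N α' β') : Prop :=
  ∀ s, exec y (s.map f) = ((exec x s).1.map g, (exec x s).2.map f)

namespace Relabels

variable {f : α → α'} {g : β → β'} {h : γ → γ'}

theorem pure (a : β) : Relabels f g (pure a : Proc p N α β) (pure (g a)) := fun _ => rfl

theorem skip : Relabels f id (Pure.pure () : Proc p N α Unit) (Pure.pure ()) := fun _ => rfl

theorem failure : Relabels f g (failure : Proc p N α β) failure := fun _ => rfl

theorem bind {x : Proc p N α β} {y : Proc p N α' β'} {k : β → Proc p N α γ}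
    {k' : β' → Proc p N α' γ'} (hx : Relabels f g x y) (hk : ∀ a, Relabels f h (k a) (k' (g a))) :
    Relabels f h (x >>= k) (y >>= k') := by
  intro s
  have hs := hx s
  rcases exec_x : exec x s with ⟨_ | a, s'⟩ <;> rw [exec_x] at hs
  · rw [exec_bind_of_none exec_x, exec_bind_of_none hs]; rfl
  · rw [exec_bind_of_some exec_x, exec_bind_of_some hs]; exact hk a s'

theorem seq {x : Proc p N α Unit} {y : Proc p N α' Unit} {k : Unit → Proc p N α γ}
    {k' : Unit → Proc p N α' γ'} (hx : Relabels f id x y) (hk : ∀ u, Relabels f h (k u) (k' u)) :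
    Relabels f h (x >>= k) (y >>= k') :=
  hx.bind hk

theorem forM_map {k : β → Proc p N α Unit} {k' : β' → Proc p N α' Unit}
    (hk : ∀ a, Relabels f id (k a) (k' (g a))) (l : List β) :
    Relabels f id (l.forM k) ((l.map g).forM k') := by
  induction l with
  | nil => exact skip
  | cons a l ih => exact (hk a).seq fun _ => ih

theorem forM {k : β → Proc p N α Unit} {k' : β → Proc p N α' Unit} (l : List β)
    (hk : ∀ a, Relabels f id (k a) (k' a)) : Relabels f id (l.forM k) (l.forM k') := by
  simpa only [List.map_id] using forM_map (g := id) hk l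

theorem getPrivate : Relabels f (Private.map f) (getPrivate : Proc p N α _) getPrivate :=
  fun _ => rfl

theorem privately {t : Private p α → Private p α} {t' : Private p α' → Private p α'}
    (ht : ∀ m, (t m).map f = t' (m.map f)) :
    Relabels f id (privately t : Proc p N α _) (privately t') := by
  intro s
  simp [State.map, ← ht]

theorem readIn (i : Fin N) : Relabels f f (readIn i : Proc p N α _) (readIn i) := fun _ => rfl

theorem readMid (j : Fin p.B) (i : ℕ) :
    Relabels f (Option.map f) (readMid j i : Proc p N α _) (readMid j i) := fun _ => rfl

theorem writeMid (j : Fin p.B) (i : ℕ) (x : Option α) :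
    Relabels f id (writeMid j i x : Proc p N α _) (writeMid j i (x.map f)) := by
  intro s
  simp only [exec_writeMid, State.map, Option.map_some, Prod.mk.injEq, State.mk.injEq, true_and,
    and_true, id]
  funext j' i'
  by_cases hj : j' = j <;> by_cases hi : i' = i <;> simp [hj, hi]

theorem writeOut (i : Fin N) (a : α) :
    Relabels f id (writeOut i a : Proc p N α _) (writeOut i (f a)) := by
  intro s
  simp only [exec_writeOut, State.map, Option.map_some, Prod.mk.injEq, State.mk.injEq, true_and,
    and_true, id]
  funext i'
  by_cases hi : i' = i <;> simp [hi]

theorem unstash (cap : ℕ) : Relabels f id (unstash cap : Proc p N α _) (unstash cap) :=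
  privately fun m => by simp [Private.map, List.map_take, List.map_drop]

theorem place (i : ℕ) (a : α) : Relabels f id (place i a : Proc p N α _) (place i (f a)) := by
  refine getPrivate.bind fun m => ?_
  have targets_map : (m.map f).targets = m.targets := rfl
  have chunk_length_map (t) : ((m.map f).chunk t).length = (m.chunk t).length := by
    simp only [Private.map, List.length_map]
  rw [targets_map]
  rcases m.targets[i]? with _ | t
  · exact failure
  simp only [Private.stashSize_map, chunk_length_map]
  split_ifs
  · refine privately fun m => ?_
    simp [Private.map, Function.apply_update fun _ => List.map (Option.map f)]
  · refine privately fun m => ?_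
    simp [Private.map, Function.apply_update fun _ => List.map f]
  · exact failure

theorem flush (cap off : ℕ) : Relabels f id (flush cap off : Proc p N α _) (flush cap off) := by
  refine (privately fun m => ?_).seq fun _ => (forM _ fun j => forM _ fun i => ?_).seq fun _ =>
    privately fun m => rfl
  · simp [Private.map]
  · refine getPrivate.bind fun m => ?_
    have getD_map : ((m.map f).chunk j).getD i none = ((m.chunk j).getD i none).map f :=
      List.getD_map _ none (Option.map f)
    rw [getD_map]
    exact writeMid _ _ _

theorem distributeBucket (ω : Coins p) (b : Fin p.B) :
    Relabels f id (distributeBucket ω b : Proc p N α _) (distributeBucket ω b) := by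
  refine (privately fun m => ?_).seq fun _ => (unstash _).seq fun _ =>
    (forM _ fun i => ?_).seq fun _ => flush _ _
  · rfl
  split_ifs
  · exact (readIn _).bind fun a => place _ _
  · exact skip

theorem drainStash : Relabels f id (drainStash : Proc p N α _) drainStash :=
  (unstash _).seq fun _ => flush _ _

theorem enqueue (a : α) : Relabels f id (enqueue a : Proc p N α _) (enqueue (f a)) := by
  refine getPrivate.bind fun m => ?_
  have queue_length_map : (m.map f).queue.length = m.queue.length := List.length_map _
  rw [queue_length_map]
  split_ifs
  · exact privately fun m => by simp [Private.map]
  · exact failure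

theorem dequeue : Relabels f f (dequeue : Proc p N α _) dequeue := by
  refine getPrivate.bind fun m => ?_
  have queue_map : (m.map f).queue = m.queue.map f := rfl
  rw [queue_map]
  rcases m.queue with _ | ⟨a, q⟩
  · exact failure
  · refine (privately fun m => ?_).seq fun _ => pure a
    rfl

theorem importIntermediate (ω : Coins p) (b : Fin p.B) :
    Relabels f id (importIntermediate ω b : Proc p N α _) (importIntermediate ω b) := by
  refine (forM _ fun i => (readMid _ _).bind fun x => privately fun m => ?_).seq fun _ =>
    (privately fun m => ?_).seq fun _ => getPrivate.bind fun m =>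
      (forM_map (fun x => ?_) m.bucket).seq fun _ => privately fun m => rfl
  · simp [Private.map]
  · have getD_map (i : ℕ) : (m.map f).bucket.getD i none = (m.bucket.getD i none).map f :=
      List.getD_map _ none (Option.map f)
    simp only [getD_map]
    simp only [Private.map, List.map_ofFn, Function.comp_def]
  · rcases x with _ | a
    · exact skip
    · exact enqueue a

theorem drainQueue (b : ℕ) : Relabels f id (drainQueue b : Proc p N α _) (drainQueue b) := by
  refine forM _ fun i => ?_
  split_ifs
  · exact dequeue.bind fun a => writeOut _ _
  · exact skip

theorem compress (ω : Coins p) : Relabels f id (compress ω : Proc p N α _) (compress ω) :=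
  (forM _ fun _ => importIntermediate _ _).seq fun _ =>
    (forM _ fun _ => (drainQueue _).seq fun _ => importIntermediate _ _).seq fun _ =>
      forM _ fun _ => drainQueue _

theorem stashShuffle (ω : Coins p) :
    Relabels f id (stashShuffle ω : Proc p N α _) (stashShuffle ω) := by
  refine (forM _ fun b => distributeBucket _ _).seq fun _ => drainStash.seq fun _ =>
    getPrivate.bind fun m => ?_
  rw [Private.stashSize_map]
  split_ifs
  · exact compress _
  · exact failure

end Relabels

theorem trace_eq_trace_id (x : Fin N → α) (ω : Coins p) :
    trace x ω = trace (id : Fin N → Fin N) ω := by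
  have relabelled := Relabels.stashShuffle (f := x) ω (initialState p id)
  rw [initialState_map, Function.comp_id] at relabelled
  exact congrArg (fun r => r.2.trace) relabelled

end Relabelling

/-! ### Obliviousness -/

section Obliviousness

variable {p : Params} {N : ℕ} {α β γ : Type}

/-- A successful run of `x` makes the accesses `T`, a failing one an initial segment of `T`. -/
def HasTrace (x : Proc p N α β) (T : List Access) : Prop :=
  ∀ s, ∃ T', T' <+: T ∧ (exec x s).2.trace = s.trace ++ T' ∧ ((exec x s).1.isSome → T' = T)

namespace HasTrace

theorem of_forall_append {x : Proc p N α β} {T : List Access}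
    (h : ∀ s, (exec x s).2.trace = s.trace ++ T) : HasTrace x T :=
  fun s => ⟨T, List.prefix_rfl, h s, fun _ => rfl⟩

theorem pure (a : β) : HasTrace (pure a : Proc p N α β) [] :=
  of_forall_append fun s => (List.append_nil s.trace).symm

theorem failure (T : List Access) : HasTrace (failure : Proc p N α β) T :=
  fun s => ⟨[], by simp⟩

theorem getPrivate : HasTrace (getPrivate : Proc p N α _) [] :=
  of_forall_append fun s => (List.append_nil s.trace).symm

theorem privately (f : Private p α → Private p α) :
    HasTrace (privately f : Proc p N α _) [] :=
  of_forall_append fun s => (List.append_nil s.trace).symm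

theorem readIn (i : Fin N) : HasTrace (readIn i : Proc p N α _) [Access.readIn i] :=
  of_forall_append fun _ => rfl

theorem readMid (j : Fin p.B) (i : ℕ) :
    HasTrace (readMid j i : Proc p N α _) [Access.readMid j i] :=
  of_forall_append fun _ => rfl

theorem writeMid (j : Fin p.B) (i : ℕ) (x : Option α) :
    HasTrace (writeMid j i x : Proc p N α _) [Access.writeMid j i] :=
  of_forall_append fun _ => rfl

theorem writeOut (i : Fin N) (a : α) :
    HasTrace (writeOut i a : Proc p N α _) [Access.writeOut i] :=
  of_forall_append fun _ => rfl

theorem bind {x : Proc p N α β} {k : β → Proc p N α γ} {T U : List Access}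
    (hx : HasTrace x T) (hk : ∀ a, HasTrace (k a) U) : HasTrace (x >>= k) (T ++ U) := by
  intro s
  obtain ⟨T', T'_prefix, trace_x, T'_eq⟩ := hx s
  rcases exec_x : exec x s with ⟨_ | a, s'⟩ <;> rw [exec_x] at trace_x T'_eq
  · rw [exec_bind_of_none exec_x]
    exact ⟨T', T'_prefix.trans (List.prefix_append _ _), trace_x, by simp⟩
  · rw [exec_bind_of_some exec_x]
    obtain ⟨U', U'_prefix, trace_k, U'_eq⟩ := hk a s'
    obtain rfl := T'_eq rfl
    refine ⟨T' ++ U', (List.prefix_append_right_inj _).2 U'_prefix, ?_, fun h => by rw [U'_eq h]⟩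
    rw [trace_k, trace_x, List.append_assoc]

theorem bind_nil_right {x : Proc p N α β} {k : β → Proc p N α γ} {T : List Access}
    (hx : HasTrace x T) (hk : ∀ a, HasTrace (k a) []) : HasTrace (x >>= k) T := by
  simpa only [List.append_nil] using hx.bind hk

theorem bind_nil_left {x : Proc p N α β} {k : β → Proc p N α γ} {T : List Access}
    (hx : HasTrace x []) (hk : ∀ a, HasTrace (k a) T) : HasTrace (x >>= k) T :=
  hx.bind hk

theorem forM {k : β → Proc p N α Unit} {T : β → List Access} (l : List β)
    (hk : ∀ a, HasTrace (k a) (T a)) : HasTrace (l.forM k) (l.flatMap T) := by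
  induction l with
  | nil => exact pure ()
  | cons a l ih =>
    rw [List.flatMap_cons]
    exact (hk a).bind fun _ => ih

theorem forM_nil {k : β → Proc p N α Unit} (l : List β)
    (hk : ∀ a, HasTrace (k a) []) : HasTrace (l.forM k) [] := by
  induction l with
  | nil => exact pure ()
  | cons a l ih => exact (hk a).bind fun _ => ih

end HasTrace

/-- The accesses of a successful `flush`. -/
def flushTrace (p : Params) (cap off : ℕ) : List Access :=
  (List.finRange p.B).flatMap fun j : Fin p.B =>
    (List.range cap).flatMap fun i => [Access.writeMid j (off + i)]

/-- The accesses of a successful `distributeBucket`. -/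
def distributeTrace (p : Params) (N : ℕ) (b : Fin p.B) : List Access :=
  ((List.range p.D).flatMap fun i =>
    if b * p.D + i < N then [Access.readIn (b * p.D + i)] else []) ++ flushTrace p p.C (b * p.C)

/-- The accesses of a successful `importIntermediate`. -/
def importTrace (p : Params) (b : Fin p.B) : List Access :=
  (List.range p.midSize).flatMap fun i => [Access.readMid b i]

/-- The accesses of a successful `drainQueue`. -/
def drainTrace (p : Params) (N b : ℕ) : List Access :=
  (List.range p.D).flatMap fun i =>
    if b * p.D + i < N then [Access.writeOut (b * p.D + i)] else []

/-- The accesses of a successful `compress`. -/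
def compressTrace (p : Params) (N : ℕ) : List Access :=
  ((List.finRange p.B).take (min p.W p.B)).flatMap (importTrace p) ++
    (((List.finRange p.B).drop (min p.W p.B)).flatMap (fun b : Fin p.B =>
      drainTrace p N (b - min p.W p.B) ++ importTrace p b) ++
    ((List.finRange p.B).drop (p.B - min p.W p.B)).flatMap (fun b : Fin p.B => drainTrace p N b))

/-- The accesses of a successful run of the Stash Shuffle. -/
def fullTrace (p : Params) (N : ℕ) : List Access :=
  (List.finRange p.B).flatMap (distributeTrace p N) ++
    (flushTrace p p.K (p.C * p.B) ++ compressTrace p N)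

namespace HasTrace

theorem unstash (cap : ℕ) : HasTrace (unstash cap : Proc p N α _) [] := privately _

theorem place (i : ℕ) (a : α) : HasTrace (place i a : Proc p N α _) [] := by
  refine getPrivate.bind_nil_left fun m => ?_
  rcases m.targets[i]? with _ | t
  · exact failure _
  dsimp only
  split_ifs
  · exact privately _
  · exact privately _
  · exact failure _

theorem flush (cap off : ℕ) :
    HasTrace (flush cap off : Proc p N α _) (flushTrace p cap off) :=
  (privately _).bind_nil_left fun _ => bind_nil_right
    (forM _ fun _ => forM _ fun _ => getPrivate.bind_nil_left fun _ => writeMid _ _ _)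
    fun _ => privately _

theorem distributeBucket (ω : Coins p) (b : Fin p.B) :
    HasTrace (distributeBucket ω b : Proc p N α _) (distributeTrace p N b) := by
  refine (privately _).bind_nil_left fun _ => (unstash _).bind_nil_left fun _ =>
    (forM _ fun i => ?_).bind fun _ => flush _ _
  split_ifs
  · exact (readIn _).bind_nil_right fun a => place _ _
  · exact pure _

theorem drainStash :
    HasTrace (drainStash : Proc p N α _) (flushTrace p p.K (p.C * p.B)) :=
  (unstash _).bind_nil_left fun _ => flush _ _

theorem enqueue (a : α) : HasTrace (enqueue a : Proc p N α _) [] := by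
  refine getPrivate.bind_nil_left fun m => ?_
  split_ifs
  · exact privately _
  · exact failure _

theorem dequeue : HasTrace (dequeue : Proc p N α _) [] := by
  refine getPrivate.bind_nil_left fun m => ?_
  rcases m.queue with _ | ⟨a, q⟩
  · exact failure _
  · exact (privately _).bind_nil_left fun _ => pure _

theorem importIntermediate (ω : Coins p) (b : Fin p.B) :
    HasTrace (importIntermediate ω b : Proc p N α _) (importTrace p b) := by
  refine bind_nil_right (forM _ fun i => (readMid _ _).bind_nil_right fun a => privately _)
    fun _ => (privately _).bind_nil_left fun _ => getPrivate.bind_nil_left fun m =>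
      (forM_nil _ fun x => ?_).bind_nil_right fun _ => privately _
  rcases x with _ | a
  · exact pure ()
  · exact enqueue a

theorem drainQueue (b : ℕ) :
    HasTrace (drainQueue b : Proc p N α _) (drainTrace p N b) := by
  refine forM _ fun i => ?_
  split_ifs
  · exact dequeue.bind_nil_left fun a => writeOut _ _
  · exact pure _

theorem compress (ω : Coins p) :
    HasTrace (compress ω : Proc p N α _) (compressTrace p N) :=
  (forM _ fun _ => importIntermediate _ _).bind fun _ =>
    bind (forM _ fun _ => (drainQueue _).bind fun _ => importIntermediate _ _) fun _ =>
      forM _ fun _ => drainQueue _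

theorem stashShuffle (ω : Coins p) :
    HasTrace (stashShuffle ω : Proc p N α _) (fullTrace p N) := by
  refine (forM _ fun b => distributeBucket _ _).bind fun _ => drainStash.bind fun _ =>
    getPrivate.bind_nil_left fun m => ?_
  split_ifs
  · exact compress _
  · exact failure _

end HasTrace

theorem oblivious (p : Params) (N : ℕ) : Oblivious p N := by
  refine ⟨⟨fullTrace p N, fun α x ω => ?_⟩, fun α x y => ?_⟩
  · obtain ⟨T', T'_prefix, trace_eq, T'_eq⟩ := HasTrace.stashShuffle ω (initialState p x)
    obtain rfl : trace x ω = T' := trace_eq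
    exact ⟨T'_prefix, fun h => T'_eq (by rwa [output, Option.isSome_map] at h)⟩
  · have trace_eq : trace (p := p) x = trace y := by
      funext ω
      rw [trace_eq_trace_id x, trace_eq_trace_id y]
    rw [trace_eq]

end Obliviousness

/-! ### Hoare triples -/

section Triples

variable {p : Params} {N : ℕ} {α β γ : Type}

/-- A Hoare triple: started in a state satisfying `P`, a successful run of `x` ends in a result and
a state satisfying `Q`, and a failing run ends in a state satisfying `E`. -/
def Triple (P : State p N α → Prop) (x : Proc p N α β) (Q : β → State p N α → Prop)
    (E : State p N α → Prop) : Prop :=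
  ∀ s, P s → match exec x s with
    | (some a, s') => Q a s'
    | (none, s') => E s'

namespace Triple

variable {P P' E : State p N α → Prop} {Q Q' : β → State p N α → Prop}
  {R : γ → State p N α → Prop}

theorem of_exec {x : Proc p N α β} (h : ∀ s, P s → ∃ a s', exec x s = (some a, s') ∧ Q a s') :
    Triple P x Q E := by
  intro s hs
  obtain ⟨a, s', exec_x, hQ⟩ := h s hs
  rw [exec_x]
  exact hQ

theorem conseq {x : Proc p N α β} (h : Triple P x Q E) (hP : ∀ s, P' s → P s)
    (hQ : ∀ a s, Q a s → Q' a s) : Triple P' x Q' E := by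
  intro s hs
  have h_s := h s (hP s hs)
  rcases exec_x : exec x s with ⟨_ | a, s'⟩ <;> rw [exec_x] at h_s
  · exact h_s
  · exact hQ a s' h_s

theorem pre {x : Proc p N α β} (h : Triple P x Q E) (hP : ∀ s, P' s → P s) : Triple P' x Q E :=
  h.conseq hP fun _ _ => id

theorem of_forall_eq {x : Proc p N α β} (h : ∀ s, P s → Triple (· = s) x Q E) :
    Triple P x Q E :=
  fun s hs => h s hs s rfl

theorem pure (a : β) (h : ∀ s, P s → Q a s) : Triple P (pure a : Proc p N α β) Q E :=
  of_exec fun s hs => ⟨a, s, rfl, h s hs⟩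

theorem failure (h : ∀ s, P s → E s) : Triple P (failure : Proc p N α β) Q E := h

theorem bind {x : Proc p N α β} {k : β → Proc p N α γ} (hx : Triple P x Q E)
    (hk : ∀ a, Triple (Q a) (k a) R E) : Triple P (x >>= k) R E := by
  intro s hs
  have h_s := hx s hs
  rcases exec_x : exec x s with ⟨_ | a, s'⟩ <;> rw [exec_x] at h_s
  · rw [exec_bind_of_none exec_x]
    exact h_s
  · rw [exec_bind_of_some exec_x]
    exact hk a s' h_s

theorem seq {x : Proc p N α Unit} {k : Unit → Proc p N α γ} {Q : State p N α → Prop}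
    (hx : Triple P x (fun _ => Q) E) (hk : ∀ u, Triple Q (k u) R E) : Triple P (x >>= k) R E :=
  hx.bind hk

theorem privately {f : Private p α → Private p α} {Q : State p N α → Prop}
    (h : ∀ s, P s → Q { s with priv := f s.priv, peak := max s.peak (f s.priv).words }) :
    Triple P (privately f) (fun _ => Q) E :=
  of_exec fun s hs => ⟨(), _, rfl, h s hs⟩

theorem getPrivate_bind {k : Private p α → Proc p N α γ}
    (h : ∀ s, P s → Triple (· = s) (k s.priv) R E) : Triple P (getPrivate >>= k) R E := by
  intro s hs
  rw [exec_bind_of_some (exec_getPrivate s)]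
  exact h s hs s rfl

theorem forM {l : List β} {k : β → Proc p N α Unit} (I : ℕ → State p N α → Prop)
    (h : ∀ i (hi : i < l.length), Triple (I i) (k l[i]) (fun _ => I (i + 1)) E) :
    Triple (I 0) (l.forM k) (fun _ => I l.length) E := by
  induction l generalizing I with
  | nil => exact pure () fun _ h => h
  | cons a l ih =>
    refine (h 0 (Nat.zero_lt_succ _)).seq fun _ => ih (fun i => I (i + 1)) fun i hi => ?_
    exact h (i + 1) (Nat.succ_lt_succ hi)

theorem forM_const {l : List β} {k : β → Proc p N α Unit}
    (h : ∀ a, Triple P (k a) (fun _ => P) E) : Triple P (l.forM k) (fun _ => P) E :=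
  forM (fun _ => P) fun _ _ => h _

theorem forM_range {n : ℕ} {k : ℕ → Proc p N α Unit} (I : ℕ → State p N α → Prop)
    (h : ∀ i < n, Triple (I i) (k i) (fun _ => I (i + 1)) E) :
    Triple (I 0) ((List.range n).forM k) (fun _ => I n) E := by
  have looped := forM (l := List.range n) (k := k) (E := E) I fun i hi => by
    rw [List.getElem_range]
    exact h i (by simpa only [List.length_range] using hi)
  rwa [List.length_range] at looped

theorem forM_take_finRange {n l : ℕ} (hl : l ≤ n) {k : Fin n → Proc p N α Unit}
    (I : ℕ → State p N α → Prop)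
    (h : ∀ b : Fin n, b < l → Triple (I b) (k b) (fun _ => I (b + 1)) E) :
    Triple (I 0) (((List.finRange n).take l).forM k) (fun _ => I l) E := by
  have length_eq : ((List.finRange n).take l).length = l := by simpa using hl
  have looped := forM (l := (List.finRange n).take l) (k := k) (E := E) I fun i hi => by
    rw [List.getElem_take, List.getElem_finRange]
    exact h ⟨i, (hi.trans_eq length_eq).trans_le hl⟩ (hi.trans_eq length_eq)
  rwa [length_eq] at looped

theorem forM_drop_finRange {n l : ℕ} (hl : l ≤ n) {k : Fin n → Proc p N α Unit}
    (I : ℕ → State p N α → Prop)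
    (h : ∀ b : Fin n, l ≤ b → Triple (I b) (k b) (fun _ => I (b + 1)) E) :
    Triple (I l) (((List.finRange n).drop l).forM k) (fun _ => I n) E := by
  have length_eq : ((List.finRange n).drop l).length = n - l := by simp
  have looped := forM (l := (List.finRange n).drop l) (k := k) (E := E) (fun i => I (l + i))
    fun i hi => by
      rw [List.getElem_drop, List.getElem_finRange]
      exact h ⟨l + i, by omega⟩ (Nat.le_add_right _ _)
  rwa [length_eq, Nat.add_sub_of_le hl] at looped

end Triple

end Triples

/-! ### Private memory -/

section Memory

variable {p : Params} {N : ℕ} {α β : Type}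

theorem Private.stashSize_push (m : Private p α) (t : Fin p.B) (a : α) :
    { m with stash := Function.update m.stash t (m.stash t ++ [a]) }.stashSize =
      m.stashSize + 1 := by
  simp only [Private.stashSize, Function.apply_update fun _ => List.length (α := α),
    List.length_append, List.length_singleton]
  rw [Finset.sum_update_of_mem (Finset.mem_univ t),
    Finset.sum_eq_add_sum_sdiff_singleton_of_mem (Finset.mem_univ t) fun j => (m.stash j).length]
  ring

/-- Bounds for the parts of the private memory that hold throughout a run; `k` is the number of
cells of the intermediate bucket loaded so far. -/
structure Private.Bounded (k : ℕ) (m : Private p α) : Prop where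
  stash : m.stashSize ≤ p.S
  chunk : ∀ j, (m.chunk j).length ≤ p.C + p.K
  targets : m.targets.length ≤ p.D
  bucket : m.bucket.length = k
  bucket_le : k ≤ p.midSize
  queue : m.queue.length ≤ p.W * p.D + p.Q

/-- The bound for the private memory that `Private.Bounded` entails. -/
def memBound (p : Params) : ℕ :=
  (p.S + p.B) + p.B * (p.C + p.K + 1) + (p.D + 1) + (p.midSize + 1) + (p.W * p.D + p.Q + 1) + 4

theorem Private.Bounded.words_le {k : ℕ} {m : Private p α} (h : m.Bounded k) :
    m.words ≤ memBound p := by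
  have stash_words : ∑ j, ((m.stash j).length + 1) = m.stashSize + p.B := by
    simp [Finset.sum_add_distrib, Private.stashSize]
  have chunk_words : ∑ j, ((m.chunk j).length + 1) ≤ p.B * (p.C + p.K + 1) := by
    simpa using Finset.sum_le_card_nsmul Finset.univ _ (p.C + p.K + 1)
      fun j _ => Nat.succ_le_succ (h.chunk j)
  have := h.stash
  have := h.targets
  have := h.bucket
  have := h.bucket_le
  have := h.queue
  unfold Private.words memBound
  omega

/-- The peak memory lies between the `B` words for the lengths of the parts of the stash and
`memBound`. -/
def PeakInRange (s : State p N α) : Prop := p.B ≤ s.peak ∧ s.peak ≤ memBound p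

/-- The invariant of the memory bound, with `k` cells of an intermediate bucket loaded. -/
structure MemInv (k : ℕ) (s : State p N α) : Prop where
  priv : s.priv.Bounded k
  peak : PeakInRange s

/-- `x` respects the memory bound and takes `MemInv k` to `MemInv l`. -/
abbrev MemStep (k l : ℕ) (x : Proc p N α β) : Prop :=
  Triple (MemInv k) x (fun _ => MemInv l) PeakInRange

theorem Triple.memInv_privately {P : State p N α → Prop} {k : ℕ} {f : Private p α → Private p α}
    (h : ∀ s, P s → PeakInRange s ∧ (f s.priv).Bounded k) :
    Triple P (StashShuffle.privately f) (fun _ => MemInv k) PeakInRange :=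
  Triple.privately fun _ hs =>
    ⟨(h _ hs).2, le_max_of_le_left (h _ hs).1.1, max_le (h _ hs).1.2 (h _ hs).2.words_le⟩

namespace MemStep

theorem privately {k l : ℕ} {f : Private p α → Private p α}
    (hf : ∀ m, m.Bounded k → (f m).Bounded l) : MemStep k l (privately f : Proc p N α _) :=
  Triple.memInv_privately fun _ hs => ⟨hs.peak, hf _ hs.priv⟩

theorem of_exec {k : ℕ} {x : Proc p N α β}
    (h : ∀ s, ∃ a s', exec x s = (some a, s') ∧ s'.priv = s.priv ∧ s'.peak = s.peak) :
    MemStep k k x := by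
  refine Triple.of_exec fun s hs => ?_
  obtain ⟨a, s', exec_x, priv_eq, peak_eq⟩ := h s
  exact ⟨a, s', exec_x, priv_eq ▸ hs.priv, by simpa only [PeakInRange, peak_eq] using hs.peak⟩

theorem pure {k : ℕ} (a : β) : MemStep k k (pure a : Proc p N α β) := Triple.pure a fun _ hs => hs

theorem unstash {k cap : ℕ} (hcap : cap ≤ p.C + p.K) :
    MemStep k k (unstash cap : Proc p N α _) := by
  refine privately fun m hm => { hm with stash := ?_, chunk := fun j => ?_ }
  · exact (Finset.sum_le_sum fun j _ => (List.drop_sublist _ _).length_le).trans hm.stash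
  · rw [List.length_map, List.length_take]
    exact (min_le_left _ _).trans hcap

theorem place {k : ℕ} (i : ℕ) (a : α) : MemStep k k (place i a : Proc p N α _) := by
  refine Triple.getPrivate_bind fun s hs => ?_
  rcases s.priv.targets[i]? with _ | t
  · exact Triple.failure fun _ h => h ▸ hs.peak
  dsimp only
  split_ifs with chunk_lt stash_lt
  · refine Triple.memInv_privately ?_
    rintro s rfl
    refine ⟨hs.peak, { hs.priv with chunk := fun j => ?_ }⟩
    change (Function.update s.priv.chunk t _ j).length ≤ _
    rcases eq_or_ne j t with rfl | hj
    · rw [Function.update_self, List.length_append, List.length_singleton]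
      omega
    · rw [Function.update_of_ne hj]
      exact hs.priv.chunk j
  · refine Triple.memInv_privately ?_
    rintro s rfl
    exact ⟨hs.peak, { hs.priv with stash := (Private.stashSize_push _ _ _).trans_le stash_lt }⟩
  · exact Triple.failure fun _ h => h ▸ hs.peak

theorem flush {k cap : ℕ} (hcap : cap ≤ p.C + p.K) (off : ℕ) :
    MemStep k k (flush cap off : Proc p N α _) := by
  refine Triple.seq (Q := MemInv k) (privately fun m hm =>
    { hm with targets := Nat.zero_le _, chunk := fun j => ?_ }) fun _ => ?_
  · have := hm.chunk j
    rw [List.length_append, List.length_replicate]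
    omega
  refine Triple.seq (Q := MemInv k) (Triple.forM_const fun j => Triple.forM_const fun i =>
    Triple.getPrivate_bind fun s hs => ?_) fun _ => ?_
  · exact Triple.pre (of_exec fun s => ⟨_, _, rfl, rfl, rfl⟩) fun _ h => h ▸ hs
  · exact privately fun m hm => { hm with chunk := fun _ => Nat.zero_le _ }

theorem distributeBucket {k : ℕ} (ω : Coins p) (b : Fin p.B) :
    MemStep k k (distributeBucket ω b : Proc p N α _) := by
  refine Triple.seq (Q := MemInv k) (privately fun m hm =>
    { hm with targets := List.length_ofFn.le }) fun _ =>
    Triple.seq (unstash (Nat.le_add_right _ _)) fun _ =>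
    Triple.seq (Q := MemInv k) (Triple.forM_const fun i => ?_) fun _ =>
      flush (Nat.le_add_right _ _) _
  split_ifs
  · exact Triple.bind (Q := fun _ => MemInv k) (of_exec fun s => ⟨_, _, rfl, rfl, rfl⟩)
      fun a => place _ _
  · exact pure ()

theorem drainStash {k : ℕ} : MemStep k k (drainStash : Proc p N α _) :=
  Triple.seq (unstash (Nat.le_add_left _ _)) fun _ => flush (Nat.le_add_left _ _) _

theorem enqueue {k : ℕ} (a : α) : MemStep k k (enqueue a : Proc p N α _) := by
  refine Triple.getPrivate_bind fun s hs => ?_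
  split_ifs with queue_lt
  · refine Triple.memInv_privately ?_
    rintro s rfl
    refine ⟨hs.peak, { hs.priv with queue := ?_ }⟩
    rwa [List.length_append, List.length_singleton]
  · exact Triple.failure fun _ h => h ▸ hs.peak

theorem dequeue {k : ℕ} : MemStep k k (dequeue : Proc p N α _) := by
  refine Triple.getPrivate_bind fun s hs => ?_
  rcases queue_eq : s.priv.queue with _ | ⟨a, q⟩
  · exact Triple.failure fun _ h => h ▸ hs.peak
  refine Triple.seq (Q := MemInv k) (Triple.memInv_privately ?_) fun _ => pure a
  rintro s rfl
  refine ⟨hs.peak, { hs.priv with queue := le_trans ?_ hs.priv.queue }⟩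
  rw [queue_eq]
  exact Nat.le_succ _

theorem importIntermediate (ω : Coins p) (b : Fin p.B) :
    MemStep 0 0 (importIntermediate ω b : Proc p N α _) := by
  refine Triple.seq (Triple.forM_range MemInv fun i hi => ?_) fun _ =>
    Triple.seq (Q := MemInv p.midSize) (privately fun m hm => ?_) fun _ =>
    Triple.getPrivate_bind fun s hs =>
    Triple.seq (Q := MemInv p.midSize)
      (Triple.pre (Triple.forM_const fun x => ?_) fun _ h => h ▸ hs)
      fun _ => privately fun m hm => { hm with bucket := rfl, bucket_le := Nat.zero_le _ }
  · refine Triple.bind (Q := fun _ => MemInv i) (of_exec fun s => ⟨_, _, rfl, rfl, rfl⟩) fun x =>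
      privately fun m hm => { hm with bucket := ?_, bucket_le := hi }
    rw [List.length_append, List.length_singleton, hm.bucket]
  · exact { hm with bucket := List.length_ofFn }
  · rcases x with _ | a
    · exact pure ()
    · exact enqueue a

theorem drainQueue {k : ℕ} (b : ℕ) : MemStep k k (drainQueue b : Proc p N α _) := by
  refine Triple.forM_const fun i => ?_
  split_ifs
  · exact Triple.bind (Q := fun _ => MemInv k) dequeue fun a =>
      of_exec fun s => ⟨_, _, rfl, rfl, rfl⟩
  · exact pure ()

theorem compress (ω : Coins p) : MemStep 0 0 (compress ω : Proc p N α _) :=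
  Triple.seq (Triple.forM_const fun _ => importIntermediate _ _) fun _ =>
    Triple.seq (Triple.forM_const fun _ =>
      Triple.seq (drainQueue _) fun _ => importIntermediate _ _) fun _ =>
      Triple.forM_const fun _ => drainQueue _

theorem stashShuffle (ω : Coins p) : MemStep 0 0 (stashShuffle ω : Proc p N α _) := by
  refine Triple.seq (Triple.forM_const fun b => distributeBucket _ _) fun _ =>
    Triple.seq drainStash fun _ => Triple.getPrivate_bind fun s hs => ?_
  split_ifs
  · exact (compress ω).pre fun _ h => h ▸ hs
  · exact Triple.failure fun _ h => h ▸ hs.peak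

end MemStep

theorem Private.bounded_empty : (Private.empty p α).Bounded 0 where
  stash := by simp [Private.stashSize, Private.empty]
  chunk _ := Nat.zero_le _
  targets := Nat.zero_le _
  bucket := rfl
  bucket_le := Nat.zero_le _
  queue := Nat.zero_le _

theorem Private.le_words (m : Private p α) : p.B ≤ m.words := by
  have stash_words : p.B ≤ ∑ j, ((m.stash j).length + 1) := by
    simp [Finset.sum_add_distrib]
  unfold Private.words
  omega

theorem memInv_initialState (x : Fin N → α) : MemInv 0 (initialState p x) where
  priv := Private.bounded_empty
  peak := ⟨Private.le_words _, Private.bounded_empty.words_le⟩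

theorem peakInRange_run (x : Fin N → α) (ω : Coins p) : PeakInRange (run x ω).2 := by
  have h := MemStep.stashShuffle ω (initialState p x) (memInv_initialState x)
  rcases exec_eq : exec (stashShuffle ω) (initialState p x) with ⟨_ | a, s'⟩ <;>
    rw [exec_eq] at h <;> rw [show run x ω = _ from exec_eq]
  · exact h
  · exact h.peak

theorem privateMemory_le (p : Params) (N : ℕ) : privateMemory p N ≤ memBound p :=
  Finset.sup_le fun _ _ => (peakInRange_run _ _).2

theorem le_privateMemory (p : Params) (N : ℕ) : p.B ≤ privateMemory p N :=
  (peakInRange_run (id : Fin N → Fin N) (Classical.arbitrary (Coins p))).1.trans <|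
    Finset.le_sup (f := fun xω : (Fin N → Fin N) × Coins p => peakMemory xω.1 xω.2)
      (b := (id, Classical.arbitrary (Coins p))) (Finset.mem_univ _)

end Memory

/-! ### Distribution phase -/

section Targets

variable {p : Params} {N : ℕ}

/-- The slot of the input buckets in which the item at a position lies. -/
def slotEmb (hN : N ≤ p.B * p.D) : Fin N ↪ Fin p.B × Fin p.D :=
  (Fin.castLEEmb hN).trans finProdFinEquiv.symm.toEmbedding

/-- The target bucket of the item at each position, given the targets `T` of all slots. -/
def itemTarget (hN : N ≤ p.B * p.D) (T : Fin p.B → Fin p.D → Fin p.B) : Fin N → Fin p.B :=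
  (fun q : Fin p.B × Fin p.D => T q.1 q.2) ∘ slotEmb hN

theorem itemTarget_apply (hN : N ≤ p.B * p.D) (T : Fin p.B → Fin p.D → Fin p.B) (b : Fin p.B)
    (i : Fin p.D) (h : b * p.D + i < N) : itemTarget hN T ⟨b * p.D + i, h⟩ = T b i := by
  have slot_eq : slotEmb hN ⟨b * p.D + i, h⟩ = (b, i) := by
    change finProdFinEquiv.symm _ = _
    rw [Equiv.symm_apply_eq]
    refine Fin.ext ?_
    simp only [Fin.castLEEmb_apply, Fin.castLE_mk, finProdFinEquiv_apply_val]
    ring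
  simp only [itemTarget, Function.comp_apply, slot_eq]

variable {α β : Type} [DecidableEq β]

/-- The positions in `[lo, hi)` of the items with target `j`. -/
def sentTo (v : Fin N → β) (j : β) (lo hi : ℕ) : Finset (Fin N) :=
  {k | v k = j ∧ lo ≤ k.val ∧ k.val < hi}

theorem mem_sentTo {v : Fin N → β} {j : β} {lo hi : ℕ} {k : Fin N} :
    k ∈ sentTo v j lo hi ↔ v k = j ∧ lo ≤ k.val ∧ k.val < hi := by
  simp [sentTo]

theorem sentTo_subset_sentTo (v : Fin N → β) (j : β) (lo : ℕ) {hi hi' : ℕ} (h : hi ≤ hi') :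
    sentTo v j lo hi ⊆ sentTo v j lo hi' := fun _ hk =>
  mem_sentTo.2 ((mem_sentTo.1 hk).imp_right fun hk => ⟨hk.1, hk.2.trans_le h⟩)

theorem sentTo_self (v : Fin N → β) (j : β) (lo : ℕ) : sentTo v j lo lo = ∅ := by
  ext k
  simp only [mem_sentTo, Finset.notMem_empty, iff_false]
  omega

theorem sentTo_of_le (v : Fin N → β) (j : β) (lo : ℕ) {hi : ℕ} (h : N ≤ hi) :
    sentTo v j lo hi = sentTo v j lo N := by
  ext k
  have := k.isLt
  rw [mem_sentTo, mem_sentTo, show k.val < hi ↔ k.val < N by omega]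

theorem sentTo_succ (v : Fin N → β) (j : β) {lo : ℕ} (k : Fin N) (h : lo ≤ k) :
    sentTo v j lo (k + 1) =
      if v k = j then insert k (sentTo v j lo k) else sentTo v j lo k := by
  ext i
  have le_iff : i.val < k + 1 ↔ i = k ∨ i.val < k := by
    rw [Nat.lt_succ_iff_lt_or_eq, Fin.ext_iff, or_comm]
  split_ifs with hv <;> simp only [mem_sentTo, Finset.mem_insert, le_iff]
  · refine ⟨by tauto, ?_⟩
    rintro (rfl | hi)
    · exact ⟨hv, h, Or.inl rfl⟩
    · exact ⟨hi.1, hi.2.1, Or.inr hi.2.2⟩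
  · refine ⟨?_, by tauto⟩
    rintro ⟨hi, lo_le, rfl | lt⟩
    · exact absurd hi hv
    · exact ⟨hi, lo_le, lt⟩

theorem notMem_sentTo (v : Fin N → β) (j : β) (lo : ℕ) (k : Fin N) : k ∉ sentTo v j lo k :=
  fun h => lt_irrefl _ (mem_sentTo.1 h).2.2

theorem card_sentTo_succ (v : Fin N → β) (j : β) {lo : ℕ} (k : Fin N) (h : lo ≤ k) :
    (sentTo v j lo (k + 1)).card = (sentTo v j lo k).card + if v k = j then 1 else 0 := by
  rw [sentTo_succ v j k h]
  split_ifs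
  · exact Finset.card_insert_of_notMem (notMem_sentTo v j lo k)
  · rfl

/-- The items with target `j` among the first `hi` items of the array `x`. -/
def itemsTo (v : Fin N → β) (x : Fin N → α) (j : β) (hi : ℕ) : Multiset α :=
  (sentTo v j 0 hi).val.map x

theorem itemsTo_zero (v : Fin N → β) (x : Fin N → α) (j : β) : itemsTo v x j 0 = 0 := by
  rw [itemsTo, sentTo_self, Finset.empty_val, Multiset.map_zero]

theorem itemsTo_of_le (v : Fin N → β) (x : Fin N → α) (j : β) {hi : ℕ} (h : N ≤ hi) :
    itemsTo v x j hi = itemsTo v x j N := by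
  rw [itemsTo, sentTo_of_le v j 0 h, itemsTo]

theorem itemsTo_succ (v : Fin N → β) (x : Fin N → α) (j : β) (k : Fin N) :
    itemsTo v x j (k + 1) = itemsTo v x j k + if v k = j then {x k} else 0 := by
  rw [itemsTo, sentTo_succ v j k (Nat.zero_le _)]
  split_ifs
  · rw [Finset.insert_val_of_notMem (notMem_sentTo v j 0 k), Multiset.map_cons,
      ← Multiset.singleton_add, add_comm, itemsTo]
  · rw [add_zero, itemsTo]

end Targets

section Cells

variable {α : Type}

/-- The items among the first `n` cells of an intermediate bucket. -/
def midItems (f : ℕ → Option α) (n : ℕ) : Multiset α := ((List.range n).map f).reduceOption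

/-- The cells `f` after the list `l`, padded with dummies, has been written into the `n` cells from
position `off` on. -/
def overwrite (off n : ℕ) (l : List (Option α)) (f : ℕ → Option α) : ℕ → Option α := fun i =>
  if off ≤ i ∧ i < off + n then l.getD (i - off) none else f i

theorem overwrite_zero (off : ℕ) (l : List (Option α)) (f : ℕ → Option α) :
    overwrite off 0 l f = f :=
  funext fun _ => if_neg (by omega)

theorem update_overwrite (off n : ℕ) (l : List (Option α)) (f : ℕ → Option α) :
    Function.update (overwrite off n l f) (off + n) (l.getD n none) =
      overwrite off (n + 1) l f := by
  funext i
  rcases eq_or_ne i (off + n) with rfl | hi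
  · rw [Function.update_self, overwrite, if_pos (by omega), Nat.add_sub_cancel_left]
  · rw [Function.update_of_ne hi, overwrite, overwrite]
    congr 1
    rw [eq_iff_iff]
    omega

theorem getD_append_replicate_none (l : List (Option α)) (n i : ℕ) :
    (l ++ List.replicate n none).getD i none = l.getD i none := by
  simp only [List.getD_eq_getElem?_getD, List.getElem?_append]
  split_ifs with hi
  · rfl
  · rw [List.getElem?_replicate, List.getElem?_eq_none (not_lt.1 hi)]
    split_ifs <;> rfl

theorem overwrite_append_replicate_none (off n k : ℕ) (l : List (Option α)) (f : ℕ → Option α) :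
    overwrite off n (l ++ List.replicate k none) f = overwrite off n l f :=
  funext fun _ => by rw [overwrite, getD_append_replicate_none, overwrite]

theorem map_range_getD_none (l : List (Option α)) {n : ℕ} (h : l.length ≤ n) :
    (List.range n).map (fun i => l.getD i none) = l ++ List.replicate (n - l.length) none := by
  have length_eq : (l ++ List.replicate (n - l.length) none).length = n := by
    rw [List.length_append, List.length_replicate, Nat.add_sub_of_le h]
  refine List.ext_getElem (by rw [List.length_map, List.length_range, length_eq]) fun i _ hi => ?_
  rw [List.getElem_map, List.getElem_range, ← getD_append_replicate_none l (n - l.length),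
    List.getD_eq_getElem _ _ hi]

theorem midItems_overwrite {off n : ℕ} {l : List (Option α)} (hl : l.length ≤ n)
    (f : ℕ → Option α) :
    midItems (overwrite off n l f) (off + n) = midItems f off + (l.reduceOption : Multiset α) := by
  have below : (List.range off).map (overwrite off n l f) = (List.range off).map f :=
    List.map_congr_left fun i hi => if_neg fun h => (List.mem_range.1 hi).not_ge h.1
  have written : (List.range n).map (overwrite off n l f ∘ (off + ·)) =
      l ++ List.replicate (n - l.length) none := by
    rw [← map_range_getD_none l hl]
    refine List.map_congr_left fun i hi => ?_
    rw [List.mem_range] at hi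
    rw [Function.comp_apply, overwrite, if_pos (by omega), Nat.add_sub_cancel_left]
  rw [midItems, List.range_add, List.map_append, List.map_map, below, written,
    List.reduceOption_append, List.reduceOption_append, List.reduceOption_replicate_none,
    List.append_nil, midItems, Multiset.coe_add]

theorem reduceOption_map_some (l : List α) : (l.map some).reduceOption = l := by
  rw [List.reduceOption, List.filterMap_map]
  exact List.filterMap_some

end Cells

section Distribution

variable {p : Params} {N : ℕ} {α β : Type}

/-- Total correctness: started in a state satisfying `P`, `x` does not fail. -/
abbrev Total (P : State p N α → Prop) (x : Proc p N α β) (Q : β → State p N α → Prop) : Prop :=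
  Triple P x Q fun _ => False

theorem Total.exists_exec_eq {P : State p N α → Prop} {x : Proc p N α β}
    {Q : β → State p N α → Prop} (h : Total P x Q) {s : State p N α} (hs : P s) :
    ∃ a s', exec x s = (some a, s') ∧ Q a s' := by
  have h_s := h s hs
  rcases exec_x : exec x s with ⟨_ | a, s'⟩ <;> rw [exec_x] at h_s
  · exact h_s.elim
  · exact ⟨a, s', rfl, h_s⟩

/-- `s` arises from `s₀` by changing the private memory to `m` and the intermediate array to `mid`,
with any trace and peak memory. -/
structure MidWritten (s₀ : State p N α) (m : Private p α) (mid : Fin p.B → ℕ → Option α)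
    (s : State p N α) : Prop where
  inp : s.inp = s₀.inp
  out : s.out = s₀.out
  priv : s.priv = m
  mid : s.mid = mid

theorem total_writeChunk (s₀ : State p N α) (m : Private p α) (mid : Fin p.B → ℕ → Option α)
    (cap off : ℕ) (j : Fin p.B) :
    Total (MidWritten s₀ m mid)
      ((List.range cap).forM fun i => do
        let m ← getPrivate
        writeMid j (off + i) ((m.chunk j).getD i none))
      fun _ => MidWritten s₀ m
        (Function.update mid j (overwrite off cap (m.chunk j) (mid j))) := by
  refine (Triple.forM_range (fun i => MidWritten s₀ m
    (Function.update mid j (overwrite off i (m.chunk j) (mid j)))) fun i _ =>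
    Triple.getPrivate_bind fun s hs => Triple.of_exec ?_).pre fun s hs => ?_
  · rintro s rfl
    refine ⟨(), _, rfl, { hs with mid := ?_ }⟩
    dsimp only
    rw [hs.mid, hs.priv, Function.update_self, update_overwrite, Function.update_idem]
  · rwa [overwrite_zero, Function.update_eq_self]

theorem total_flush (cap off : ℕ) (s₀ : State p N α) :
    Total (· = s₀) (flush cap off) fun _ =>
      MidWritten s₀ { s₀.priv with targets := [], chunk := fun _ => [] }
        fun j => overwrite off cap (s₀.priv.chunk j) (s₀.mid j) := by
  let padded : Private p α := { s₀.priv with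
    targets := []
    chunk := fun j => s₀.priv.chunk j ++ List.replicate (cap - (s₀.priv.chunk j).length) none }
  let written (n : ℕ) (j : Fin p.B) : ℕ → Option α :=
    if j < n then overwrite off cap (padded.chunk j) (s₀.mid j) else s₀.mid j
  have written_succ (b : Fin p.B) : Function.update (written b) b
      (overwrite off cap (padded.chunk b) (written b b)) = written (b + 1) := by
    funext j
    rcases eq_or_ne j b with rfl | hj
    · simp only [Function.update_self, written, lt_irrefl, if_false, Nat.lt_succ_self, if_true]
    · have : j.val ≠ b := Fin.val_ne_of_ne hj
      simp only [Function.update_of_ne hj, written, show j.val < b + 1 ↔ j.val < b by omega]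
  refine Triple.seq (Q := MidWritten s₀ padded (written 0)) (Triple.privately ?_) fun _ =>
    Triple.seq (Triple.forM_drop_finRange (Nat.zero_le _)
      (fun n => MidWritten s₀ padded (written n)) fun b _ => ?_) fun _ =>
    Triple.privately fun s hs => ?_
  · rintro s rfl
    exact ⟨rfl, rfl, rfl, funext fun _ => (if_neg (Nat.not_lt_zero _)).symm⟩
  · rw [← written_succ]
    exact total_writeChunk s₀ padded _ cap off b
  · refine { hs with priv := by rw [hs.priv], mid := hs.mid.trans (funext fun j => ?_) }
    rw [← overwrite_append_replicate_none off cap (cap - (s₀.priv.chunk j).length)]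
    exact if_pos j.2

/-- The targets are such that no part of the stash ever holds more than `κ` items: after input
bucket `b`, the part belonging to `j` holds the excess, over the capacity of the chunks, of the
items sent to `j` since it was last empty. -/
structure StashGood (p : Params) (v : Fin N → Fin p.B) (κ : ℕ) : Prop where
  card_sentTo_le : ∀ j a b, a ≤ b → b < p.B →
    (sentTo v j (a * p.D) ((b + 1) * p.D)).card ≤ (b + 1 - a) * p.C + κ
  lt_stash : p.B * κ < p.S
  le_drain : κ ≤ p.K

/-- The invariant between two input buckets, `n` of which have been distributed. In `busy`, the part
of the stash belonging to `j` was last empty after `a` buckets, so all chunks for `j` since then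
were full. -/
structure BucketInv (v : Fin N → Fin p.B) (x : Fin N → α) (n : ℕ) (s : State p N α) : Prop where
  inp : s.inp = x
  chunk : s.priv.chunk = fun _ => []
  bucket : s.priv.bucket = []
  queue : s.priv.queue = []
  content : ∀ j, midItems (s.mid j) (n * p.C) + (s.priv.stash j : Multiset α) =
    itemsTo v x j (n * p.D)
  busy : ∀ j, ∃ a ≤ n, (s.priv.stash j).length + (n - a) * p.C =
    (sentTo v j (a * p.D) (n * p.D)).card

/-- The invariant within input bucket `b`, `i` slots of which have been distributed; `T` is the list
of their targets. -/
structure SlotInv (v : Fin N → Fin p.B) (x : Fin N → α) (T : List (Fin p.B)) (b i : ℕ)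
    (s : State p N α) : Prop where
  inp : s.inp = x
  targets : s.priv.targets = T
  bucket : s.priv.bucket = []
  queue : s.priv.queue = []
  content : ∀ j, midItems (s.mid j) (b * p.C) + ((s.priv.chunk j).reduceOption : Multiset α) +
    (s.priv.stash j : Multiset α) = itemsTo v x j (b * p.D + i)
  chunk_le : ∀ j, (s.priv.chunk j).length ≤ p.C
  full : ∀ j, s.priv.stash j ≠ [] → (s.priv.chunk j).length = p.C
  busy : ∀ j, ∃ a ≤ b, (s.priv.chunk j).length + (s.priv.stash j).length + (b - a) * p.C =
    (sentTo v j (a * p.D) (b * p.D + i)).card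

section Bucket

variable {v : Fin N → Fin p.B} {x : Fin N → α} {T : List (Fin p.B)} {b i κ : ℕ}

theorem SlotInv.length_stash_le {s : State p N α} (h : SlotInv v x T b i s) (hg : StashGood p v κ)
    (hb : b < p.B) (hi : i ≤ p.D) (j : Fin p.B) : (s.priv.stash j).length ≤ κ := by
  by_cases stash_eq : s.priv.stash j = []
  · rw [stash_eq]
    exact Nat.zero_le _
  obtain ⟨a, ha, busy⟩ := h.busy j
  rw [h.full j stash_eq] at busy
  have sent_le := hg.card_sentTo_le j a b ha hb
  have end_le : b * p.D + i ≤ (b + 1) * p.D := by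
    rw [Nat.succ_mul]
    omega
  have sent_mono := Finset.card_le_card (sentTo_subset_sentTo v j (a * p.D) end_le)
  rw [Nat.sub_add_comm ha, Nat.succ_mul (b - a)] at sent_le
  omega

theorem SlotInv.stashSize_lt {s : State p N α} (h : SlotInv v x T b i s) (hg : StashGood p v κ)
    (hb : b < p.B) (hi : i ≤ p.D) : s.priv.stashSize < p.S := by
  refine lt_of_le_of_lt ?_ hg.lt_stash
  simpa [Private.stashSize] using
    Finset.sum_le_card_nsmul Finset.univ _ κ fun j _ => h.length_stash_le hg hb hi j

theorem SlotInv.push_chunk {s : State p N α} (hs : SlotInv v x T b i s) (h : b * p.D + i < N)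
    {t : Fin p.B} (ht : v ⟨b * p.D + i, h⟩ = t) (chunk_lt : (s.priv.chunk t).length < p.C)
    (peak : ℕ) :
    SlotInv v x T b (i + 1) { s with
      peak := peak
      priv := { s.priv with
        chunk := Function.update s.priv.chunk t
          (s.priv.chunk t ++ [some (x ⟨b * p.D + i, h⟩)]) } } := by
  refine { hs with
    content := fun j => ?_, chunk_le := fun j => ?_, full := fun j stash_ne => ?_,
    busy := fun j => ?_ } <;> dsimp only at *
  · refine Eq.trans ?_ (itemsTo_succ v x j ⟨b * p.D + i, h⟩).symm
    rw [ht, ← hs.content j]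
    rcases eq_or_ne j t with rfl | hj
    · rw [Function.update_self, if_pos rfl, List.reduceOption_append, List.reduceOption_singleton,
        Option.toList_some, ← Multiset.coe_add, Multiset.coe_singleton]
      abel
    · rw [Function.update_of_ne hj, if_neg hj.symm, add_zero]
  · rcases eq_or_ne j t with rfl | hj
    · rw [Function.update_self, List.length_append]
      exact chunk_lt
    · rw [Function.update_of_ne hj]
      exact hs.chunk_le j
  · rcases eq_or_ne j t with rfl | hj
    · exact absurd (hs.full j stash_ne) chunk_lt.ne
    · rw [Function.update_of_ne hj]
      exact hs.full j stash_ne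
  · obtain ⟨a, ha, busy⟩ := hs.busy j
    refine ⟨a, ha, Eq.trans ?_ (card_sentTo_succ v j ⟨b * p.D + i, h⟩
      ((Nat.mul_le_mul_right _ ha).trans (Nat.le_add_right _ _))).symm⟩
    rw [ht, ← busy]
    rcases eq_or_ne j t with rfl | hj
    · rw [Function.update_self, if_pos rfl, List.length_append, List.length_singleton]
      ring
    · rw [Function.update_of_ne hj, if_neg hj.symm, add_zero]

theorem SlotInv.push_stash {s : State p N α} (hs : SlotInv v x T b i s) (h : b * p.D + i < N)
    {t : Fin p.B} (ht : v ⟨b * p.D + i, h⟩ = t) (chunk_full : p.C ≤ (s.priv.chunk t).length)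
    (peak : ℕ) :
    SlotInv v x T b (i + 1) { s with
      peak := peak
      priv := { s.priv with
        stash := Function.update s.priv.stash t (s.priv.stash t ++ [x ⟨b * p.D + i, h⟩]) } } := by
  refine { hs with content := fun j => ?_, full := fun j stash_ne => ?_, busy := fun j => ?_ } <;>
    dsimp only at *
  · refine Eq.trans ?_ (itemsTo_succ v x j ⟨b * p.D + i, h⟩).symm
    rw [ht, ← hs.content j]
    rcases eq_or_ne j t with rfl | hj
    · rw [Function.update_self, if_pos rfl, ← Multiset.coe_add, Multiset.coe_singleton,
        ← add_assoc]
    · rw [Function.update_of_ne hj, if_neg hj.symm, add_zero]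
  · rcases eq_or_ne j t with rfl | hj
    · exact (hs.chunk_le j).antisymm chunk_full
    · rw [Function.update_of_ne hj] at stash_ne
      exact hs.full j stash_ne
  · obtain ⟨a, ha, busy⟩ := hs.busy j
    refine ⟨a, ha, Eq.trans ?_ (card_sentTo_succ v j ⟨b * p.D + i, h⟩
      ((Nat.mul_le_mul_right _ ha).trans (Nat.le_add_right _ _))).symm⟩
    rw [ht, ← busy]
    rcases eq_or_ne j t with rfl | hj
    · rw [Function.update_self, if_pos rfl, List.length_append, List.length_singleton]
      ring
    · rw [Function.update_of_ne hj, if_neg hj.symm, add_zero]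

theorem total_place (hg : StashGood p v κ) (hb : b < p.B) (hi : i < p.D) (h : b * p.D + i < N)
    (hT : T[i]? = some (v ⟨b * p.D + i, h⟩)) :
    Total (SlotInv v x T b i) (place i (x ⟨b * p.D + i, h⟩))
      fun _ => SlotInv v x T b (i + 1) := by
  refine Triple.getPrivate_bind fun s hs => ?_
  rw [hs.targets, hT]
  dsimp only
  split_ifs with chunk_lt stash_lt
  · refine Triple.privately ?_
    rintro s rfl
    exact hs.push_chunk h rfl chunk_lt _
  · refine Triple.privately ?_
    rintro s rfl
    exact hs.push_stash h rfl (not_lt.1 chunk_lt) _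
  · exact absurd (hs.stashSize_lt hg hb hi.le) stash_lt

theorem total_unstash : Total (fun s => BucketInv v x b s ∧ s.priv.targets = T) (unstash p.C)
    fun _ => SlotInv v x T b 0 := by
  refine Triple.privately ?_
  rintro s ⟨hs, targets_eq⟩
  refine ⟨hs.inp, targets_eq, hs.bucket, hs.queue, fun j => ?_, fun j => ?_, fun j stash_ne => ?_,
    fun j => ?_⟩ <;> dsimp only at *
  · rw [add_zero, ← hs.content j, reduceOption_map_some, add_assoc, Multiset.coe_add,
      List.take_append_drop]
  · rw [List.length_map, List.length_take]
    exact min_le_left _ _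
  · rw [Ne, List.drop_eq_nil_iff, not_le] at stash_ne
    rw [List.length_map, List.length_take, min_eq_left stash_ne.le]
  · obtain ⟨a, ha, busy⟩ := hs.busy j
    refine ⟨a, ha, ?_⟩
    rw [add_zero, ← busy, List.length_map, ← List.length_append, List.take_append_drop]

theorem total_flush_bucket :
    Total (SlotInv v x T b p.D) (flush p.C (b * p.C)) fun _ => BucketInv v x (b + 1) := by
  refine Triple.of_forall_eq fun s hs =>
    (total_flush p.C (b * p.C) s).conseq (fun _ => id) fun _ s' hs' => ?_
  refine ⟨hs'.inp.trans hs.inp, by rw [hs'.priv], by rw [hs'.priv, hs.bucket],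
    by rw [hs'.priv, hs.queue], fun j => ?_, fun j => ?_⟩ <;>
    rw [hs'.priv, Nat.succ_mul b p.D] <;> dsimp only
  · rw [← hs.content j, hs'.mid, Nat.succ_mul, midItems_overwrite (hs.chunk_le j)]
  · by_cases stash_eq : s.priv.stash j = []
    · refine ⟨b + 1, le_rfl, ?_⟩
      rw [stash_eq, Nat.sub_self, Nat.succ_mul b p.D, sentTo_self, zero_mul]
      rfl
    · obtain ⟨a, ha, busy⟩ := hs.busy j
      refine ⟨a, ha.trans (Nat.le_succ _), ?_⟩
      rw [← busy, hs.full j stash_eq, Nat.sub_add_comm ha]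
      ring

end Bucket

variable {x : Fin N → α} {κ : ℕ} (hN : N ≤ p.B * p.D) (ω : Coins p)

theorem total_distributeBucket (hg : StashGood p (itemTarget hN ω.targets) κ) (b : Fin p.B) :
    Total (BucketInv (itemTarget hN ω.targets) x b) (distributeBucket ω b)
      fun _ => BucketInv (itemTarget hN ω.targets) x (b + 1) := by
  let v := itemTarget hN ω.targets
  let T := List.ofFn (ω.targets b)
  refine Triple.seq (Q := fun s => BucketInv v x b s ∧ s.priv.targets = T)
    (Triple.privately fun s hs => ⟨{ hs with }, rfl⟩) fun _ =>
    Triple.seq total_unstash fun _ =>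
    Triple.seq (Triple.forM_range (SlotInv v x T b) fun i hi => ?_) fun _ => total_flush_bucket
  split_ifs with h
  · refine Triple.bind (Q := fun a s => a = x ⟨b * p.D + i, h⟩ ∧ SlotInv v x T b i s)
      (Triple.of_exec fun s hs => ⟨_, _, rfl, by rw [hs.inp], { hs with }⟩) fun a => ?_
    rintro s ⟨rfl, hs⟩
    refine total_place hg b.2 hi h ?_ s hs
    rw [itemTarget_apply hN ω.targets b ⟨i, hi⟩ h]
    simp [T, hi]
  · have N_le : N ≤ b * p.D + i := not_lt.1 h
    have N_le_succ : N ≤ b * p.D + (i + 1) := by omega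
    refine Triple.pure () fun s hs => { hs with content := fun j => ?_, busy := fun j => ?_ }
    · rw [hs.content, itemsTo_of_le v x j N_le, itemsTo_of_le v x j N_le_succ]
    · obtain ⟨a, ha, busy⟩ := hs.busy j
      refine ⟨a, ha, busy.trans ?_⟩
      rw [sentTo_of_le v j _ N_le, sentTo_of_le v j _ N_le_succ]

theorem BucketInv.length_stash_le {v : Fin N → Fin p.B} {s : State p N α}
    (hs : BucketInv v x p.B s) (hg : StashGood p v κ) (j : Fin p.B) :
    (s.priv.stash j).length ≤ p.K := by
  obtain ⟨a, ha, busy⟩ := hs.busy j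
  rcases ha.eq_or_lt with rfl | ha
  · rw [sentTo_self, Finset.card_empty] at busy
    omega
  · have sent_le := hg.card_sentTo_le j a (p.B - 1) (by omega) (by omega)
    rw [Nat.sub_add_cancel (by omega)] at sent_le
    have := hg.le_drain
    omega

/-- The distribution phase. -/
def distribution (ω : Coins p) : Proc p N α Unit := do
  (List.finRange p.B).forM fun b => distributeBucket ω b
  drainStash

/-- What the compression phase finds: all items with target `j` in intermediate bucket `j`, and the
lists it uses empty. -/
structure Distributed (v : Fin N → Fin p.B) (x : Fin N → α) (s : State p N α) : Prop where
  stashSize : s.priv.stashSize = 0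
  bucket : s.priv.bucket = []
  queue : s.priv.queue = []
  midItems : ∀ j, midItems (s.mid j) p.midSize = itemsTo v x j N

theorem total_drainStash (hN : N ≤ p.B * p.D) {v : Fin N → Fin p.B} (hg : StashGood p v κ) :
    Total (BucketInv v x p.B) drainStash fun _ => Distributed v x := by
  refine Triple.seq (Q := fun s => Distributed v x
    { s with mid := fun j => overwrite (p.C * p.B) p.K (s.priv.chunk j) (s.mid j) })
    (Triple.privately fun s hs => ?_) fun _ => Triple.of_forall_eq fun s hs => ?_
  · have stash_le := hs.length_stash_le hg
    refine ⟨?_, hs.bucket, hs.queue, fun j => ?_⟩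
    · exact Finset.sum_eq_zero fun j _ => by
        rw [List.length_drop, Nat.sub_eq_zero_of_le (stash_le j)]
    · dsimp only
      rw [Params.midSize, midItems_overwrite ((List.length_map ..).trans_le ?_),
        reduceOption_map_some, List.take_of_length_le (stash_le j), mul_comm p.C, hs.content,
        itemsTo_of_le v x j hN]
      exact (List.length_take ..).trans_le (min_le_left _ _)
  · refine (total_flush p.K (p.C * p.B) s).conseq (fun _ => id) fun _ s' hs' => ?_
    refine ⟨?_, ?_, ?_, ?_⟩
    · rw [hs'.priv]
      exact hs.stashSize
    · rw [hs'.priv]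
      exact hs.bucket
    · rw [hs'.priv]
      exact hs.queue
    · rw [hs'.mid]
      exact hs.midItems

theorem total_distribution (hg : StashGood p (itemTarget hN ω.targets) κ) :
    Total (BucketInv (itemTarget hN ω.targets) x 0) (distribution ω)
      fun _ => Distributed (itemTarget hN ω.targets) x :=
  Triple.seq (Triple.forM_drop_finRange (Nat.zero_le _) (BucketInv (itemTarget hN ω.targets) x)
    fun b _ => total_distributeBucket hN ω hg b) fun _ => total_drainStash hN hg

theorem bucketInv_initialState (v : Fin N → Fin p.B) (x : Fin N → α) :
    BucketInv v x 0 (initialState p x) where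
  inp := rfl
  chunk := rfl
  bucket := rfl
  queue := rfl
  content j := by rw [zero_mul, zero_mul, itemsTo_zero]; rfl
  busy j := ⟨0, le_rfl, by rw [sentTo_self, Nat.sub_zero, zero_mul]; rfl⟩

end Distribution

/-! ### Compression phase -/

section Compression

variable {p : Params} {N : ℕ} {α : Type}

/-- The items of intermediate bucket `b` in the order in which they are exported. -/
def exported (mid : Fin p.B → ℕ → Option α) (ω : Coins p) (b : Fin p.B) : List α :=
  (List.ofFn fun i : Fin p.midSize => mid b (ω.perms b i)).reduceOption

/-- The items of the first `n` intermediate buckets in the order in which they are exported. -/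
def imported (mid : Fin p.B → ℕ → Option α) (ω : Coins p) (n : ℕ) : List α :=
  ((List.finRange p.B).take n).flatMap (exported mid ω)

theorem coe_exported (mid : Fin p.B → ℕ → Option α) (ω : Coins p) (b : Fin p.B) :
    (exported mid ω b : Multiset α) = midItems (mid b) p.midSize := by
  have cells_eq : (List.range p.midSize).map (mid b) =
      List.ofFn fun i : Fin p.midSize => mid b i :=
    List.ext_getElem (by simp) fun i _ _ => by simp
  rw [exported, midItems, Multiset.coe_eq_coe, cells_eq]
  exact List.Perm.filterMap _
    (Equiv.Perm.ofFn_comp_perm (ω.perms b) fun i : Fin p.midSize => mid b i)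

theorem imported_zero (mid : Fin p.B → ℕ → Option α) (ω : Coins p) : imported mid ω 0 = [] := by
  rw [imported, List.take_zero, List.flatMap_nil]

theorem imported_succ (mid : Fin p.B → ℕ → Option α) (ω : Coins p) (b : Fin p.B) :
    imported mid ω (b + 1) = imported mid ω b ++ exported mid ω b := by
  have getElem?_eq : (List.finRange p.B)[b.val]? = some b := by simp
  rw [imported, List.take_add_one, List.flatMap_append, getElem?_eq, Option.toList_some,
    List.flatMap_singleton, imported]

theorem length_imported {v : Fin N → Fin p.B} {x : Fin N → α} {mid : Fin p.B → ℕ → Option α}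
    {ω : Coins p} (h : ∀ j, (exported mid ω j : Multiset α) = itemsTo v x j N) {n : ℕ}
    (hn : n ≤ p.B) :
    (imported mid ω n).length = (Finset.univ.filter fun k : Fin N => (v k).val < n).card := by
  induction n with
  | zero => simp [imported_zero]
  | succ n ih =>
    have length_exported : (exported mid ω ⟨n, hn⟩).length =
        (Finset.univ.filter fun k : Fin N => (v k).val = n).card := by
      rw [← Multiset.coe_card, h, itemsTo, Multiset.card_map, Finset.card_val]
      congr 1
      ext k
      simp [mem_sentTo, Fin.ext_iff]
    rw [imported_succ mid ω ⟨n, hn⟩, List.length_append, ih (Nat.le_of_succ_le hn),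
      length_exported, ← Finset.card_union_of_disjoint
        (Finset.disjoint_filter.2 fun k _ lt eq => lt.ne eq), ← Finset.filter_or]
    simp only [Nat.lt_succ_iff_lt_or_eq]

/-- The contents of the memory that the compression phase works with. -/
structure Buffers (mid : Fin p.B → ℕ → Option α) (out : Fin N → Option α)
    (bucket : List (Option α)) (queue : List α) (s : State p N α) : Prop where
  mid : s.mid = mid
  out : s.out = out
  bucket : s.priv.bucket = bucket
  queue : s.priv.queue = queue

section Buffers

variable {mid : Fin p.B → ℕ → Option α} {out : Fin N → Option α} {bucket : List (Option α)}
  {queue : List α}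

theorem total_load (b : Fin p.B) :
    Total (Buffers mid out [] queue)
      ((List.range p.midSize).forM fun i => do
        let x ← readMid b i
        privately fun m => { m with bucket := m.bucket ++ [x] })
      fun _ => Buffers mid out ((List.range p.midSize).map (mid b)) queue := by
  refine Triple.forM_range (fun i => Buffers mid out ((List.range i).map (mid b)) queue)
    fun i _ => Triple.of_exec fun s hs => ⟨(), _, rfl, { hs with bucket := ?_ }⟩
  dsimp only
  rw [hs.bucket, hs.mid, List.range_succ, List.map_append, List.map_singleton]

theorem total_enqueue {a : α} (h : queue.length < p.W * p.D + p.Q) :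
    Total (Buffers mid out bucket queue) (enqueue a)
      fun _ => Buffers mid out bucket (queue ++ [a]) := by
  refine Triple.getPrivate_bind fun s hs => ?_
  rw [hs.queue, if_pos h]
  refine Triple.privately ?_
  rintro s rfl
  exact { hs with queue := congrArg (· ++ [a]) hs.queue }

theorem total_enqueue_items (l : List (Option α)) {queue : List α}
    (h : queue.length + l.reduceOption.length ≤ p.W * p.D + p.Q) :
    Total (Buffers mid out bucket queue)
      (l.forM fun x => match x with
        | none => pure ()
        | some a => enqueue a)
      fun _ => Buffers mid out bucket (queue ++ l.reduceOption) := by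
  induction l generalizing queue with
  | nil => exact Triple.pure () fun s hs => by rwa [List.reduceOption_nil, List.append_nil]
  | cons x l ih =>
    rcases x with _ | a
    · rw [List.reduceOption_cons_of_none] at h ⊢
      exact (Triple.pure () fun _ => id).seq fun _ => ih h
    · rw [List.reduceOption_cons_of_some] at h ⊢
      rw [List.length_cons] at h
      refine (total_enqueue (by omega)).seq fun _ => ?_
      rw [List.append_cons queue a l.reduceOption]
      refine ih ?_
      rw [List.length_append, List.length_singleton]
      omega

theorem total_importIntermediate (ω : Coins p) (b : Fin p.B)
    (h : queue.length + (exported mid ω b).length ≤ p.W * p.D + p.Q) :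
    Total (Buffers mid out [] queue) (importIntermediate ω b)
      fun _ => Buffers mid out [] (queue ++ exported mid ω b) := by
  let shuffled := List.ofFn fun i : Fin p.midSize => mid b (ω.perms b i)
  refine Triple.seq (total_load b) fun _ =>
    Triple.seq (Q := Buffers mid out shuffled queue) (Triple.privately fun s hs => ?_) fun _ =>
    Triple.getPrivate_bind fun s hs => ?_
  · refine { hs with bucket := ?_ }
    simp [hs.bucket, shuffled]
  · rw [hs.bucket]
    refine (Triple.seq
      (total_enqueue_items (mid := mid) (out := out) (bucket := shuffled) shuffled h) fun _ =>
      Triple.privately fun s hs => { hs with bucket := rfl }).pre ?_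
    rintro s rfl
    exact hs

theorem total_dequeue (a : α) :
    Total (Buffers mid out bucket (a :: queue)) dequeue
      fun r s => r = a ∧ Buffers mid out bucket queue s := by
  refine Triple.getPrivate_bind fun s hs => ?_
  rw [hs.queue]
  refine Triple.of_exec ?_
  rintro s rfl
  exact ⟨a, _, rfl, rfl, { hs with queue := rfl }⟩

end Buffers

/-- The invariant of the compression phase: the items `l` have been imported, and the first `d` of
them have been exported. -/
structure CompressInv (mid : Fin p.B → ℕ → Option α) (l : List α) (d : ℕ)
    (s : State p N α) : Prop where
  mid : s.mid = mid
  bucket : s.priv.bucket = []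
  queue : s.priv.queue = l.drop d
  out : ∀ i : Fin N, i.val < d → s.out i = l[i.val]?

section CompressInv

variable {mid : Fin p.B → ℕ → Option α} {l : List α} {d : ℕ}

theorem total_importIntermediate_compressInv (ω : Coins p) (b : Fin p.B) (hd : d ≤ l.length)
    (h : (l ++ exported mid ω b).length ≤ d + (p.W * p.D + p.Q)) :
    Total (CompressInv mid l d : State p N α → Prop) (importIntermediate ω b)
      fun _ => CompressInv mid (l ++ exported mid ω b) d := by
  rw [List.length_append] at h
  refine Triple.of_forall_eq fun s hs =>
    (total_importIntermediate (mid := mid) (out := s.out) (queue := l.drop d) ω b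
      (by rw [List.length_drop]; omega)).conseq ?_ fun _ s' hs' => ?_
  · rintro s rfl
    exact ⟨hs.mid, rfl, hs.bucket, hs.queue⟩
  · refine ⟨hs'.mid, hs'.bucket, ?_, fun i hi => ?_⟩
    · rw [hs'.queue, List.drop_append_of_le_length hd]
    · rw [hs'.out, hs.out i hi, List.getElem?_append_left (hi.trans_le hd)]

theorem total_export (hN : d < N) (hd : d < l.length) :
    Total (CompressInv mid l d : State p N α → Prop)
      (do
        let a ← dequeue
        writeOut ⟨d, hN⟩ a)
      fun _ => CompressInv mid l (d + 1) := by
  refine Triple.of_forall_eq fun s hs => Triple.bind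
    ((total_dequeue (mid := mid) (out := s.out) (bucket := []) (queue := l.drop (d + 1)) l[d]).pre
      ?_) fun a => Triple.of_exec ?_
  · rintro s rfl
    exact ⟨hs.mid, rfl, hs.bucket, by rw [hs.queue, List.drop_eq_getElem_cons hd]⟩
  · rintro s' ⟨rfl, hs'⟩
    refine ⟨(), _, rfl, hs'.mid, hs'.bucket, hs'.queue, fun i hi => ?_⟩
    rcases eq_or_ne i ⟨d, hN⟩ with rfl | ne
    · exact (Function.update_self ..).trans (List.getElem?_eq_getElem hd).symm
    · dsimp only
      rw [Function.update_of_ne ne, hs'.out]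
      exact hs.out i ((Nat.le_of_lt_succ hi).lt_of_ne (Fin.val_ne_of_ne ne))

theorem total_drainQueue (b : ℕ) (h : min ((b + 1) * p.D) N ≤ l.length) :
    Total (CompressInv mid l (min (b * p.D) N) : State p N α → Prop) (drainQueue b)
      fun _ => CompressInv mid l (min ((b + 1) * p.D) N) := by
  rw [Nat.succ_mul] at h ⊢
  refine Triple.forM_range (fun i => CompressInv mid l (min (b * p.D + i) N)) fun i hi => ?_
  split_ifs with lt
  · rw [min_eq_left lt.le, min_eq_left (show b * p.D + (i + 1) ≤ N by omega)]
    exact total_export lt (by omega)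
  · rw [min_eq_right (not_lt.1 lt), min_eq_right (show N ≤ b * p.D + (i + 1) by omega)]
    exact Triple.pure () fun _ => id

end CompressInv

/-- When the first `n` intermediate buckets hold `M n` items, the queue neither overflows nor
underflows. -/
structure QueueGood (p : Params) (N : ℕ) (M : ℕ → ℕ) : Prop where
  le_cap : ∀ b < p.B, M (b + 1) ≤ min ((b + 1 - min p.W p.B) * p.D) N + (p.W * p.D + p.Q)
  enough : ∀ b, min p.W p.B ≤ b → b < p.B → min ((b + 1 - min p.W p.B) * p.D) N ≤ M b

theorem total_compress (hN : N ≤ p.B * p.D) {mid : Fin p.B → ℕ → Option α} (ω : Coins p)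
    {M : ℕ → ℕ} (hM : ∀ n ≤ p.B, (imported mid ω n).length = M n) (hMB : M p.B = N)
    (hg : QueueGood p N M) :
    Total (CompressInv mid [] 0 : State p N α → Prop) (compress ω)
      fun _ s => ∀ i : Fin N, s.out i = (imported mid ω p.B)[i.val]? := by
  let L := min p.W p.B
  have L_le : L ≤ p.B := min_le_right _ _
  have importing_total (b : Fin p.B) (d : ℕ) (hd : d ≤ M b)
      (h : M (b + 1) ≤ d + (p.W * p.D + p.Q)) :
      Total (CompressInv mid (imported mid ω b) d : State p N α → Prop) (importIntermediate ω b)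
        fun _ => CompressInv mid (imported mid ω (b + 1)) d := by
    rw [← hM _ b.2.le] at hd
    rw [← hM _ b.2, imported_succ] at h
    rw [imported_succ]
    exact total_importIntermediate_compressInv ω b hd h
  have L_sub : L - L = 0 := Nat.sub_self L
  refine Triple.seq (Q := CompressInv mid (imported mid ω L) (min ((L - L) * p.D) N)) ?_ fun _ =>
    Triple.seq (Triple.forM_drop_finRange L_le (fun n =>
      CompressInv mid (imported mid ω n) (min ((n - L) * p.D) N)) fun b hb => ?_) fun _ => ?_
  · rw [L_sub, zero_mul, Nat.zero_min, ← imported_zero mid ω]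
    refine Triple.forM_take_finRange L_le (fun n => CompressInv mid (imported mid ω n) 0)
      fun b hb => importing_total b 0 (Nat.zero_le _) ?_
    simpa [L, Nat.sub_eq_zero_of_le (Nat.succ_le_of_lt hb)] using hg.le_cap b b.2
  · have enough := hg.enough b hb b.2
    have le_cap := hg.le_cap b b.2
    rw [Nat.sub_add_comm hb] at enough le_cap ⊢
    refine (total_drainQueue (b - L) (by rwa [hM _ b.2.le])).seq fun _ => ?_
    exact importing_total b _ enough le_cap
  · refine (Triple.forM_drop_finRange (Nat.sub_le p.B L) (fun n =>
      CompressInv mid (imported mid ω p.B) (min (n * p.D) N)) fun b _ => ?_).conseq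
      (fun _ => id) fun _ s hs i => hs.out i ?_
    · refine total_drainQueue b ?_
      rw [hM _ le_rfl, hMB]
      exact min_le_right _ _
    · rw [min_eq_right hN]
      exact i.2

/-- The targets are such that the shuffle does not fail. -/
def Good (p : Params) (N κ : ℕ) (v : Fin N → Fin p.B) : Prop :=
  StashGood p v κ ∧
    QueueGood p N fun n => (Finset.univ.filter fun k : Fin N => (v k).val < n).card

theorem distribution_congr {ω ω' : Coins p} (h : ω.targets = ω'.targets) :
    (distribution ω : Proc p N α Unit) = distribution ω' := by
  simp only [distribution, distributeBucket, h]

theorem stashShuffle_eq (ω : Coins p) :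
    (stashShuffle ω : Proc p N α Unit) = (distribution ω >>= fun _ => getPrivate >>= fun m =>
      if m.stashSize = 0 then compress ω else failure) := by
  rw [stashShuffle, distribution, bind_assoc]

/-- The intermediate array after the distribution phase; the permutations play no role in it. -/
def midArray (x : Fin N → α) (T : Fin p.B → Fin p.D → Fin p.B) : Fin p.B → ℕ → Option α :=
  (exec (distribution ⟨T, fun _ => 1⟩) (initialState p x)).2.mid

/-- The output as a list, provided that the run on input `x` with random choices `ω` succeeds. -/
def outputList (x : Fin N → α) (ω : Coins p) : List α :=
  imported (midArray x ω.targets) ω p.B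

/-- A successful run on input `x`, in terms of the lists the buckets are exported in. -/
structure Succeeds (hN : N ≤ p.B * p.D) (x : Fin N → α) (ω : Coins p) : Prop where
  coe_exported_eq : ∀ j, (exported (midArray x ω.targets) ω j : Multiset α) =
    itemsTo (itemTarget hN ω.targets) x j N
  length_outputList : (outputList x ω).length = N
  output_eq : output x ω = some fun i => (outputList x ω)[i.val]?

theorem succeeds_of_good (hN : N ≤ p.B * p.D) (x : Fin N → α) {κ : ℕ} (ω : Coins p)
    (hg : Good p N κ (itemTarget hN ω.targets)) : Succeeds hN x ω := by
  let v := itemTarget hN ω.targets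
  obtain ⟨_, s, exec_distribution, hs⟩ :=
    (total_distribution hN ω hg.1).exists_exec_eq (bucketInv_initialState v x)
  have mid_eq : midArray x ω.targets = s.mid := by
    rw [midArray, distribution_congr (ω := ⟨ω.targets, fun _ => 1⟩) (ω' := ω) rfl,
      exec_distribution]
  have coe_exported_eq (j) : (exported s.mid ω j : Multiset α) = itemsTo v x j N := by
    rw [coe_exported, hs.midItems]
  have sentBelow_B : (Finset.univ.filter fun k : Fin N => (v k).val < p.B).card = N := by simp
  obtain ⟨_, t, exec_compress, ht⟩ := (total_compress hN ω
    (fun n hn => length_imported coe_exported_eq hn) sentBelow_B hg.2).exists_exec_eq (s := s)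
      ⟨rfl, hs.bucket, hs.queue, fun i hi => absurd hi (Nat.not_lt_zero _)⟩
  have exec_eq : exec (stashShuffle ω) (initialState p x) = (some (), t) := by
    rw [stashShuffle_eq, exec_bind_of_some exec_distribution,
      exec_bind_of_some (exec_getPrivate s), if_pos hs.stashSize, exec_compress]
  refine ⟨mid_eq ▸ coe_exported_eq, ?_, ?_⟩
  · rw [outputList, mid_eq, length_imported coe_exported_eq le_rfl, sentBelow_B]
  · change (exec (stashShuffle ω) (initialState p x)).1.map
      (fun _ => (exec (stashShuffle ω) (initialState p x)).2.out) = _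
    rw [exec_eq, outputList, mid_eq]
    exact congrArg some (funext ht)

end Compression

/-! ### Counting arrangements -/

section Counting

open Finset

section Permutations

variable {α : Type*} {m : ℕ}

theorem filter_ofFn_ofSubtype_mul (P : Fin m → Prop) [DecidablePred P]
    (τ : Equiv.Perm {i // P i}) (σ : Equiv.Perm (Fin m)) :
    (List.ofFn ⇑(Equiv.Perm.ofSubtype τ * σ)).filter P =
      ((List.ofFn σ).filter P).map (Equiv.Perm.ofSubtype τ) := by
  have ofSubtype_iff (i : Fin m) : P (Equiv.Perm.ofSubtype τ i) ↔ P i := by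
    by_cases h : P i
    · rw [Equiv.Perm.ofSubtype_apply_of_mem τ h]
      exact iff_of_true (τ ⟨i, h⟩).2 h
    · rw [Equiv.Perm.ofSubtype_apply_of_not_mem τ h]
  rw [Equiv.Perm.coe_mul, ← List.map_ofFn, List.filter_map]
  simp only [Function.comp_def, ofSubtype_iff]

theorem card_perm_filter_ofFn_mul_factorial_le (P : Fin m → Prop) [DecidablePred P]
    (o : List (Fin m)) :
    #{σ : Equiv.Perm (Fin m) | (List.ofFn σ).filter P = o} *
      (Fintype.card {i // P i}).factorial ≤ m.factorial := by
  let permute (q : Equiv.Perm (Fin m) × Equiv.Perm {i // P i}) : Equiv.Perm (Fin m) :=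
    Equiv.Perm.ofSubtype q.2 * q.1
  rw [← Fintype.card_perm, ← card_univ (α := Equiv.Perm {i // P i}), ← card_product]
  refine (card_le_card_of_injOn (t := univ) permute (fun _ _ => mem_coe.2 (mem_univ _)) ?_).trans
    (by rw [card_univ, Fintype.card_perm, Fintype.card_fin])
  rintro ⟨σ, τ⟩ hσ ⟨σ', τ'⟩ hσ' permute_eq
  simp only [coe_product, coe_univ, Set.mem_prod, Set.mem_univ, and_true, coe_filter, mem_univ,
    true_and, Set.mem_ofPred_eq] at hσ hσ'
  change Equiv.Perm.ofSubtype τ * σ = Equiv.Perm.ofSubtype τ' * σ' at permute_eq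
  have map_eq := filter_ofFn_ofSubtype_mul P τ σ
  rw [permute_eq, filter_ofFn_ofSubtype_mul, hσ, hσ', List.map_inj_left] at map_eq
  have ofSubtype_eq : Equiv.Perm.ofSubtype τ = Equiv.Perm.ofSubtype τ' := by
    refine Equiv.ext fun i => ?_
    by_cases hi : P i
    · refine (map_eq i ?_).symm
      rw [← hσ, List.mem_filter]
      exact ⟨List.mem_ofFn.2 (σ.surjective i), decide_eq_true hi⟩
    · rw [Equiv.Perm.ofSubtype_apply_of_not_mem τ hi, Equiv.Perm.ofSubtype_apply_of_not_mem τ' hi]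
  rw [ofSubtype_eq] at permute_eq
  rw [Equiv.Perm.ofSubtype_injective ofSubtype_eq, mul_left_cancel permute_eq]

theorem eq_of_nodup_reduceOption_ofFn {l : Fin m → Option α}
    (hl : (List.ofFn l).reduceOption.Nodup) {i j : Fin m} {a : α} (hi : l i = some a)
    (hj : l j = some a) : i = j := by
  rw [List.Nodup, List.reduceOption, List.pairwise_filterMap, List.pairwise_ofFn] at hl
  rcases lt_trichotomy i j with lt | eq | lt
  · exact absurd rfl (hl lt a hi a hj)
  · exact eq
  · exact absurd rfl (hl lt a hj a hi)

theorem filter_isSome_eq_of_reduceOption_map_eq {l : Fin m → Option α}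
    (hl : (List.ofFn l).reduceOption.Nodup) {L L' : List (Fin m)}
    (h : (L.map l).reduceOption = (L'.map l).reduceOption) :
    L.filter (fun i => (l i).isSome) = L'.filter fun i => (l i).isSome := by
  classical
  let position (a : α) : Option (Fin m) :=
    if h : ∃ i, l i = some a then some h.choose else none
  have bind_position (i : Fin m) :
      (l i).bind position = Option.guard (fun i => (l i).isSome) i := by
    rcases hi : l i with _ | a
    · rw [Option.guard, if_neg (by simp [hi]), Option.bind_none]
    · have exists_i : ∃ i, l i = some a := ⟨i, hi⟩
      simp [hi, position, exists_i,
        eq_of_nodup_reduceOption_ofFn hl exists_i.choose_spec hi]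
  have filter_eq (L : List (Fin m)) :
      L.filter (fun i => (l i).isSome) = (L.map l).reduceOption.filterMap position := by
    rw [List.reduceOption, List.filterMap_map, List.filterMap_filterMap,
      ← List.filterMap_eq_filter]
    simp only [Function.comp_apply, id_eq, bind_position]
  rw [filter_eq, filter_eq, h]

theorem length_reduceOption_ofFn (l : Fin m → Option α) :
    (List.ofFn l).reduceOption.length = Fintype.card {i // (l i).isSome} := by
  rw [Fintype.card_subtype, List.reduceOption_length_eq, ← List.countP_eq_length_filter,
    List.ofFn_eq_map, List.countP_map]
  rw [card_def, filter_val, ← Multiset.countP_eq_card_filter, Fin.univ_def, Multiset.coe_countP]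
  simp only [Function.comp_def, Bool.decide_eq_true]

theorem card_perm_reduceOption_ofFn_mul_factorial_le [DecidableEq α] {l : Fin m → Option α}
    (hl : (List.ofFn l).reduceOption.Nodup) (o : List α) :
    #{σ : Equiv.Perm (Fin m) | (List.ofFn fun i => l (σ i)).reduceOption = o} *
      (List.ofFn l).reduceOption.length.factorial ≤ m.factorial := by
  rcases eq_empty_or_nonempty
    {σ : Equiv.Perm (Fin m) | (List.ofFn fun i => l (σ i)).reduceOption = o} with h | ⟨σ₀, hσ₀⟩
  · rw [h, card_empty, zero_mul]
    exact Nat.zero_le _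
  rw [length_reduceOption_ofFn]
  refine (Nat.mul_le_mul_right _ (card_le_card fun σ hσ => ?_)).trans
    (card_perm_filter_ofFn_mul_factorial_le (fun i => (l i).isSome)
      ((List.ofFn σ₀).filter fun i => (l i).isSome))
  rw [mem_filter_univ] at hσ hσ₀ ⊢
  simp only [Bool.decide_eq_true]
  refine filter_isSome_eq_of_reduceOption_map_eq hl ?_
  rw [List.map_ofFn, List.map_ofFn]
  exact hσ.trans hσ₀.symm

end Permutations

section Fibres

variable {κ β : Type*} [Fintype κ] [DecidableEq β]

/-- The number of arguments at which `s` takes the value `j`. -/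
def fiberCard (s : κ → β) (j : β) : ℕ := #{k | s k = j}

theorem fiberCard_comp_perm (s : κ → β) (σ : Equiv.Perm κ) : fiberCard (s ∘ σ) = fiberCard s :=
  funext fun j => card_equiv σ fun k => by simp

theorem sum_fiberCard [Fintype β] (s : κ → β) : ∑ j, fiberCard s j = Fintype.card κ :=
  (card_eq_sum_card_fiberwise fun _ _ => mem_coe.2 (mem_univ _)).symm

theorem count_map_univ_val (s : κ → β) (j : β) :
    (univ.val.map s).count j = fiberCard s j := by
  rw [Multiset.count_map, fiberCard, card_def, filter_val]
  simp only [eq_comm]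

end Fibres

section Monotone

variable {β : Type*} [LinearOrder β] {N : ℕ}

theorem eq_of_monotone_of_fiberCard_eq {s t : Fin N → β} (hs : Monotone s) (ht : Monotone t)
    (h : fiberCard s = fiberCard t) : s = t := by
  have perm : (List.ofFn s).Perm (List.ofFn t) := by
    rw [← Multiset.coe_eq_coe, ← Fin.univ_val_map, ← Fin.univ_val_map]
    ext j
    rw [count_map_univ_val, count_map_univ_val, h]
  exact List.ofFn_injective (perm.eq_of_pairwise (le := (· ≤ ·)) (fun _ _ _ _ => le_antisymm)
    (List.pairwise_ofFn.2 fun _ _ lt => hs lt.le) (List.pairwise_ofFn.2 fun _ _ lt => ht lt.le))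

variable [Fintype β]

theorem sum_piAntidiag_prod_inv_factorial (N : ℕ) :
    ∑ k ∈ (univ : Finset β).piAntidiag N, ∏ j, ((k j).factorial : ℝ)⁻¹ =
      (Fintype.card β : ℝ) ^ N / N.factorial := by
  have multinomial_eq : ∀ k ∈ (univ : Finset β).piAntidiag N,
      (Nat.multinomial univ k : ℝ) = N.factorial * ∏ j, ((k j).factorial : ℝ)⁻¹ := by
    intro k hk
    have prod_ne_zero : ∏ j, ((k j).factorial : ℝ) ≠ 0 :=
      prod_ne_zero_iff.2 fun j _ => Nat.cast_ne_zero.2 (Nat.factorial_ne_zero _)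
    rw [prod_inv_distrib, ← (mem_piAntidiag.1 hk).1, ← Nat.multinomial_spec univ k,
      Nat.cast_mul, Nat.cast_prod]
    field_simp
  have sum_pow := sum_pow_eq_sum_piAntidiag (univ : Finset β) (fun _ => (1 : ℝ)) N
  simp only [sum_const, card_univ, nsmul_eq_mul, mul_one, one_pow, prod_const_one] at sum_pow
  rw [sum_pow, sum_congr rfl multinomial_eq, ← mul_sum,
    mul_div_cancel_left₀ _ (Nat.cast_ne_zero.2 (Nat.factorial_ne_zero _))]

open scoped Classical in
/-- The number `1 / ∏ j, (fiberCard v j)!` if `ρ` sorts `v`, and `0` otherwise: given the targets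
`v` of the items, an upper bound for the probability that the shuffle succeeds and moves the item
at position `ρ i` to position `i`, for all `i`. -/
noncomputable def sortWeight (ρ : Equiv.Perm (Fin N)) (v : Fin N → β) : ℝ :=
  if Monotone (v ∘ ρ) then ∏ j, ((fiberCard v j).factorial : ℝ)⁻¹ else 0

theorem sortWeight_nonneg (ρ : Equiv.Perm (Fin N)) (v : Fin N → β) : 0 ≤ sortWeight ρ v := by
  rw [sortWeight]
  split_ifs
  · exact prod_nonneg fun _ _ => by positivity
  · exact le_rfl

theorem sum_sortWeight_le (ρ : Equiv.Perm (Fin N)) :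
    ∑ v : Fin N → β, sortWeight ρ v ≤ (Fintype.card β : ℝ) ^ N / N.factorial := by
  classical
  have sum_eq : ∑ v : Fin N → β, sortWeight ρ v =
      ∑ s : Fin N → β with Monotone s, ∏ j, ((fiberCard s j).factorial : ℝ)⁻¹ := by
    rw [sum_filter]
    refine Fintype.sum_equiv (Equiv.arrowCongr ρ.symm (Equiv.refl _)) _ _ fun v => ?_
    change sortWeight ρ v = if Monotone (v ∘ ρ) then
      ∏ j, ((fiberCard (v ∘ ρ) j).factorial : ℝ)⁻¹ else 0
    rw [fiberCard_comp_perm, sortWeight]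
  rw [sum_eq, ← sum_piAntidiag_prod_inv_factorial,
    ← sum_image (f := fun k : β → ℕ => ∏ j, ((k j).factorial : ℝ)⁻¹) (g := fiberCard)
      fun s hs t ht => eq_of_monotone_of_fiberCard_eq (mem_filter.1 hs).2 (mem_filter.1 ht).2]
  refine sum_le_sum_of_subset_of_nonneg (fun k hk => ?_) fun _ _ _ =>
    prod_nonneg fun _ _ => by positivity
  obtain ⟨s, -, rfl⟩ := mem_image.1 hk
  exact mem_piAntidiag.2 ⟨(sum_fiberCard s).trans (Fintype.card_fin N), fun _ _ => mem_univ _⟩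

end Monotone

theorem sum_comp_embedding {ι κ β R : Type*} [Fintype ι] [Fintype κ] [Fintype β] [DecidableEq ι]
    [DecidableEq κ] [CommSemiring R] (e : κ ↪ ι) (F : (κ → β) → R) :
    (∑ u : ι → β, F (u ∘ e)) * (Fintype.card β : R) ^ Fintype.card κ =
      (Fintype.card β : R) ^ Fintype.card ι * ∑ s, F s := by
  classical
  let split : (ι → β) ≃ (κ → β) × (↥(Set.range e)ᶜ → β) :=
    (Equiv.arrowCongr (((Equiv.ofInjective e e.injective).sumCongr (Equiv.refl _)).trans
      (Equiv.Set.sumCompl (Set.range e))).symm (Equiv.refl β)).trans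
      (Equiv.sumArrowEquivProdArrow _ _ _)
  have split_fst (u : ι → β) : (split u).1 = u ∘ e := funext fun k => by simp [split]
  have card_eq : Fintype.card ↥(Set.range e)ᶜ + Fintype.card κ = Fintype.card ι := by
    rw [Fintype.card_compl_set, Set.card_range_of_injective e.injective]
    exact Nat.sub_add_cancel (Fintype.card_le_of_embedding e)
  have sum_eq : ∑ u : ι → β, F (u ∘ e) = ∑ q : (κ → β) × (↥(Set.range e)ᶜ → β), F q.1 :=
    Fintype.sum_equiv split _ _ fun u => by rw [split_fst]
  rw [sum_eq, Fintype.sum_prod_type]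
  simp only [sum_const, card_univ, Fintype.card_fun, nsmul_eq_mul]
  rw [← mul_sum, ← card_eq, pow_add, Nat.cast_pow]
  ring

end Counting

/-! ### Distance from uniform -/

section Distance

open Finset

section UniformPushforward

variable {Ω Ω' : Type}

section

variable [Fintype Ω']

theorem sum_toReal_apply (P : PMF Ω') : ∑ a, (P a).toReal = 1 := by
  rw [← ENNReal.toReal_sum fun a _ => P.apply_ne_top a, ← tsum_fintype (L := .unconditional _),
    P.tsum_coe, ENNReal.toReal_one]

theorem statDist_le_sum {P Q : PMF Ω'} {e : Ω' → ℝ} (he : ∀ a, 0 ≤ e a)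
    (h : ∀ a, (P a).toReal ≤ (Q a).toReal + e a) : statDist P Q ≤ ∑ a, e a := by
  have sum_abs_le : ∑ a, |(P a).toReal - (Q a).toReal| ≤
      ∑ a, (2 * e a - ((P a).toReal - (Q a).toReal)) := by
    refine sum_le_sum fun a _ => abs_le.2 ⟨?_, ?_⟩ <;> linarith [h a, he a]
  rw [sum_sub_distrib, sum_sub_distrib, sum_toReal_apply, sum_toReal_apply, ← mul_sum] at sum_abs_le
  rw [statDist]
  linarith

end

variable [Fintype Ω] [Nonempty Ω] [DecidableEq Ω']

theorem toReal_map_uniformOfFintype_apply (f : Ω → Ω') (a : Ω') :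
    ((PMF.uniformOfFintype Ω).map f a).toReal = (#{ω | f ω = a} : ℝ) / Fintype.card Ω := by
  classical
  rw [PMF.map_apply, tsum_fintype]
  simp only [PMF.uniformOfFintype_apply]
  rw [← sum_filter, sum_const, nsmul_eq_mul, ENNReal.toReal_mul, ENNReal.toReal_inv,
    ENNReal.toReal_natCast, ENNReal.toReal_natCast, div_eq_mul_inv]
  simp only [eq_comm]

theorem statDist_map_uniformOfFintype_le [Fintype Ω'] (f : Ω → Ω') (Q : PMF Ω') (good : Ω → Prop)
    [DecidablePred good]
    (h : ∀ a, (#{ω | good ω ∧ f ω = a} : ℝ) / Fintype.card Ω ≤ (Q a).toReal) :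
    statDist ((PMF.uniformOfFintype Ω).map f) Q ≤ (#{ω | ¬good ω} : ℝ) / Fintype.card Ω := by
  refine (statDist_le_sum (e := fun a => (#{ω | ¬good ω ∧ f ω = a} : ℝ) / Fintype.card Ω)
    (fun a => by positivity) fun a => ?_).trans_eq ?_
  · have card_eq : #{ω | f ω = a} = #{ω | good ω ∧ f ω = a} + #{ω | ¬good ω ∧ f ω = a} := by
      rw [← card_filter_add_card_filter_not good, filter_filter, filter_filter]
      simp only [and_comm]
    rw [toReal_map_uniformOfFintype_apply, card_eq, Nat.cast_add, add_div]
    exact add_le_add_left (h a) _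
  · rw [← sum_div, ← Nat.cast_sum,
      card_eq_sum_card_fiberwise (f := f) (t := univ) fun _ _ => mem_coe.2 (mem_univ _)]
    simp only [filter_filter]

end UniformPushforward

theorem filter_flatMap_eq {ι α : Type*} [DecidableEq ι] {l : List ι} (hl : l.Nodup) {j : ι}
    (hj : j ∈ l) {f : ι → List α} {key : α → ι} (hkey : ∀ i, ∀ a ∈ f i, key a = i) :
    (l.flatMap f).filter (key · = j) = f j := by
  have filter_eq (i : ι) : (f i).filter (key · = j) = if i = j then f i else [] := by
    split_ifs with h
    · exact List.filter_eq_self.2 fun a ha => decide_eq_true ((hkey i a ha).trans h)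
    · exact List.filter_eq_nil_iff.2 fun a ha => by rwa [decide_eq_true_iff, hkey i a ha]
  obtain ⟨l₁, l₂, rfl⟩ := List.append_of_mem hj
  have notMem := (List.nodup_middle.1 hl).notMem
  rw [List.mem_append, not_or] at notMem
  have filter_eq_nil {l : List ι} (h : j ∉ l) :
      (l.flatMap fun i => (f i).filter (key · = j)) = [] :=
    List.flatMap_eq_nil_iff.2 fun i hi => by
      rw [filter_eq, if_neg (ne_of_mem_of_not_mem hi h)]
  rw [List.filter_flatMap, List.flatMap_append, List.flatMap_cons, filter_eq_nil notMem.1,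
    filter_eq_nil notMem.2, filter_eq, if_pos rfl, List.nil_append, List.append_nil]

variable {p : Params} {N : ℕ}

theorem mem_itemsTo {α : Type} {v : Fin N → Fin p.B} {x : Fin N → α} {j : Fin p.B} {a : α} :
    a ∈ itemsTo v x j N ↔ ∃ k, v k = j ∧ x k = a := by
  simp [itemsTo, mem_sentTo]

theorem nodup_itemsTo {α : Type} (v : Fin N → Fin p.B) {x : Fin N → α}
    (hx : Function.Injective x) (j : Fin p.B) (n : ℕ) : (itemsTo v x j n).Nodup :=
  (Finset.nodup _).map hx

theorem card_itemsTo {α : Type} (v : Fin N → Fin p.B) (x : Fin N → α) (j : Fin p.B) :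
    (itemsTo v x j N).card = fiberCard v j := by
  rw [itemsTo, Multiset.card_map, ← Finset.card_def, fiberCard]
  exact congrArg card (ext fun k => by simp [mem_sentTo])

theorem outputList_eq_flatMap {α : Type} (x : Fin N → α) (ω : Coins p) :
    outputList x ω = (List.finRange p.B).flatMap (exported (midArray x ω.targets) ω) := by
  rw [outputList, imported, List.take_of_length_le (List.length_finRange).le]

section Succeeds

variable {hN : N ≤ p.B * p.D} {x : Equiv.Perm (Fin N)} {ω : Coins p}

theorem Succeeds.itemTarget_symm_of_mem (h : Succeeds hN x ω) (j : Fin p.B) (a : Fin N)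
    (ha : a ∈ exported (midArray x ω.targets) ω j) :
    itemTarget hN ω.targets (x.symm a) = j := by
  rw [← Multiset.mem_coe, h.coe_exported_eq, mem_itemsTo] at ha
  obtain ⟨k, hk, rfl⟩ := ha
  rwa [x.symm_apply_apply]

theorem Succeeds.mem_outputList (h : Succeeds hN x ω) (a : Fin N) : a ∈ outputList x ω := by
  rw [outputList_eq_flatMap, List.mem_flatMap]
  refine ⟨itemTarget hN ω.targets (x.symm a), List.mem_finRange _, ?_⟩
  rw [← Multiset.mem_coe, h.coe_exported_eq, mem_itemsTo]
  exact ⟨x.symm a, rfl, x.apply_symm_apply a⟩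

theorem Succeeds.exists_output_eq (h : Succeeds hN x ω) :
    ∃ π : Equiv.Perm (Fin N), output x ω = some fun i => some (π i) := by
  have lt_length (i : Fin N) : i.val < (outputList x ω).length :=
    i.2.trans_eq h.length_outputList.symm
  let item (i : Fin N) : Fin N := (outputList x ω)[i.val]'(lt_length i)
  have item_surjective : Function.Surjective item := by
    intro a
    obtain ⟨i, hi, getElem_eq⟩ := List.getElem_of_mem (h.mem_outputList a)
    exact ⟨⟨i, h.length_outputList ▸ hi⟩, getElem_eq⟩
  refine ⟨Equiv.ofBijective item ⟨Finite.injective_iff_surjective.2 item_surjective,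
    item_surjective⟩, ?_⟩
  rw [h.output_eq]
  exact congrArg some (funext fun i => List.getElem?_eq_getElem (lt_length i))

variable {π : Equiv.Perm (Fin N)}

theorem Succeeds.outputList_eq_ofFn (h : Succeeds hN x ω)
    (ho : output x ω = some fun i => some (π i)) : outputList x ω = List.ofFn π := by
  refine List.ext_getElem (by rw [h.length_outputList, List.length_ofFn]) fun i hi _ => ?_
  rw [h.output_eq, Option.some.injEq] at ho
  have getElem?_eq := congrFun ho ⟨i, h.length_outputList ▸ hi⟩
  rw [List.getElem?_eq_getElem hi, Option.some.injEq] at getElem?_eq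
  rw [getElem?_eq, List.getElem_ofFn]

theorem Succeeds.monotone_itemTarget (h : Succeeds hN x ω)
    (ho : output x ω = some fun i => some (π i)) :
    Monotone (itemTarget hN ω.targets ∘ π.trans x.symm) := by
  have pairwise_le : (List.ofFn π).Pairwise fun a b =>
      itemTarget hN ω.targets (x.symm a) ≤ itemTarget hN ω.targets (x.symm b) := by
    rw [← h.outputList_eq_ofFn ho, outputList_eq_flatMap, List.pairwise_flatMap]
    refine ⟨fun j _ => List.pairwise_of_forall_mem_list fun a ha b hb => ?_,
      (List.pairwise_lt_finRange _).imp fun {i j} lt a ha b hb => ?_⟩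
    · rw [h.itemTarget_symm_of_mem j a ha, h.itemTarget_symm_of_mem j b hb]
    · rw [h.itemTarget_symm_of_mem i a ha, h.itemTarget_symm_of_mem j b hb]
      exact lt.le
  rw [List.pairwise_ofFn] at pairwise_le
  exact monotone_iff_forall_lt.2 fun i j lt => pairwise_le lt

theorem Succeeds.exported_eq_filter (h : Succeeds hN x ω)
    (ho : output x ω = some fun i => some (π i)) (j : Fin p.B) :
    exported (midArray x ω.targets) ω j =
      (List.ofFn π).filter fun a => itemTarget hN ω.targets (x.symm a) = j := by
  rw [← h.outputList_eq_ofFn ho, outputList_eq_flatMap,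
    filter_flatMap_eq (List.nodup_finRange _) (List.mem_finRange j) h.itemTarget_symm_of_mem]

theorem Succeeds.coe_reduceOption_ofFn (h : Succeeds hN x ω) (j : Fin p.B) :
    ((List.ofFn fun i : Fin p.midSize => midArray x ω.targets j i).reduceOption :
      Multiset (Fin N)) = itemsTo (itemTarget hN ω.targets) x j N := by
  rw [← h.coe_exported_eq, coe_exported, ← coe_exported _ (⟨ω.targets, fun _ => 1⟩ : Coins p)]
  rfl

theorem Succeeds.card_perms_bucket_le (h : Succeeds hN x ω) (j : Fin p.B) (o : List (Fin N)) :
    (#{σ : Equiv.Perm (Fin p.midSize) |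
        (List.ofFn fun i => midArray x ω.targets j (σ i)).reduceOption = o} : ℝ) ≤
      p.midSize.factorial * ((fiberCard (itemTarget hN ω.targets) j).factorial : ℝ)⁻¹ := by
  let bucket (i : Fin p.midSize) : Option (Fin N) := midArray x ω.targets j i
  have nodup_bucket : (List.ofFn bucket).reduceOption.Nodup := by
    rw [← Multiset.coe_nodup, h.coe_reduceOption_ofFn j]
    exact nodup_itemsTo _ x.injective _ _
  have length_bucket :
      (List.ofFn bucket).reduceOption.length = fiberCard (itemTarget hN ω.targets) j := by
    rw [← Multiset.coe_card, h.coe_reduceOption_ofFn j, card_itemsTo]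
  rw [← div_eq_mul_inv, le_div_iff₀ (by positivity), ← length_bucket]
  exact_mod_cast card_perm_reduceOption_ofFn_mul_factorial_le nodup_bucket o

end Succeeds

section Coins

theorem sum_coins (F : Coins p → ℝ) : ∑ ω, F ω = ∑ T, ∑ s, F ⟨T, s⟩ := by
  rw [← Fintype.sum_prod_type']
  exact Fintype.sum_equiv (coinsEquiv p) _ _ fun _ => rfl

theorem card_coins (p : Params) : (Fintype.card (Coins p) : ℝ) =
    (p.midSize.factorial : ℝ) ^ p.B * (p.B : ℝ) ^ (p.B * p.D) := by
  rw [Fintype.card_congr (coinsEquiv p)]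
  simp only [Fintype.card_prod, Fintype.card_fun, Fintype.card_fin, Fintype.card_perm,
    Nat.cast_mul, Nat.cast_pow]
  rw [← pow_mul, mul_comm p.D, mul_comm]

theorem sum_perms (T : Fin p.B → Fin p.D → Fin p.B) (F : (Fin p.B → Fin p.D → Fin p.B) → ℝ) :
    ∑ _s : Fin p.B → Equiv.Perm (Fin p.midSize), F T = (p.midSize.factorial : ℝ) ^ p.B * F T := by
  simp [Fintype.card_perm]

theorem average_coins_itemTarget (hB : 0 < p.B) (hN : N ≤ p.B * p.D) (F : (Fin N → Fin p.B) → ℝ) :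
    (∑ ω : Coins p, F (itemTarget hN ω.targets)) / Fintype.card (Coins p) =
      (∑ v, F v) / (p.B : ℝ) ^ N := by
  have sum_targets : (∑ T, F (itemTarget hN T)) * (p.B : ℝ) ^ N =
      (p.B : ℝ) ^ (p.B * p.D) * ∑ v, F v := by
    have sum_comp := sum_comp_embedding (β := Fin p.B) (slotEmb hN) F
    simp only [Fintype.card_fin, Fintype.card_prod] at sum_comp
    rw [← sum_comp]
    exact congrArg (· * _)
      (Fintype.sum_equiv (Equiv.curry (Fin p.B) (Fin p.D) (Fin p.B)) _ _ fun _ => rfl).symm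
  rw [sum_coins, card_coins]
  simp only [sum_perms _ fun T => F (itemTarget hN T)]
  rw [← mul_sum, mul_div_mul_left _ _ (by positivity), div_eq_div_iff (by positivity)
    (by positivity), sum_targets, mul_comm]

end Coins

open scoped Classical in
theorem card_perms_output_eq_le (hN : N ≤ p.B * p.D) (x π : Equiv.Perm (Fin N))
    (T : Fin p.B → Fin p.D → Fin p.B) :
    (#{s : Fin p.B → Equiv.Perm (Fin p.midSize) | Succeeds hN x ⟨T, s⟩ ∧
        output x (⟨T, s⟩ : Coins p) = some fun i => some (π i)} : ℝ) ≤
      (p.midSize.factorial : ℝ) ^ p.B * sortWeight (π.trans x.symm) (itemTarget hN T) := by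
  set successes : Finset (Fin p.B → Equiv.Perm (Fin p.midSize)) :=
    {s | Succeeds hN x ⟨T, s⟩ ∧ output x (⟨T, s⟩ : Coins p) = some fun i => some (π i)}
  rcases successes.eq_empty_or_nonempty with empty | ⟨s₀, hs₀⟩
  · rw [empty, card_empty, Nat.cast_zero]
    exact mul_nonneg (by positivity) (sortWeight_nonneg _ _)
  obtain ⟨succeeds, output_eq⟩ := (mem_filter_univ _).1 hs₀
  have subset_piFinset : successes ⊆ Fintype.piFinset fun j =>
      {σ : Equiv.Perm (Fin p.midSize) | (List.ofFn fun i => midArray x T j (σ i)).reduceOption =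
        (List.ofFn π).filter fun a => itemTarget hN T (x.symm a) = j} := by
    intro s hs
    obtain ⟨succeeds, output_eq⟩ := (mem_filter_univ _).1 hs
    exact Fintype.mem_piFinset.2 fun j =>
      (mem_filter_univ _).2 (succeeds.exported_eq_filter output_eq j)
  refine (Nat.cast_le.2 ((card_le_card subset_piFinset).trans_eq
    (Fintype.card_piFinset _))).trans ?_
  have prod_const_factorial :
      (p.midSize.factorial : ℝ) ^ p.B = ∏ _j : Fin p.B, (p.midSize.factorial : ℝ) := by simp
  rw [sortWeight, if_pos (succeeds.monotone_itemTarget output_eq), Nat.cast_prod,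
    prod_const_factorial, ← prod_mul_distrib]
  exact prod_le_prod (fun _ _ => Nat.cast_nonneg _) fun j _ => succeeds.card_perms_bucket_le j _

open scoped Classical in
theorem card_coins_output_eq_le (hB : 0 < p.B) (hN : N ≤ p.B * p.D) (x π : Equiv.Perm (Fin N)) :
    (#{ω : Coins p | Succeeds hN x ω ∧ output x ω = some fun i => some (π i)} : ℝ) /
      Fintype.card (Coins p) ≤ 1 / N.factorial := by
  have card_le_sum :
      (#{ω : Coins p | Succeeds hN x ω ∧ output x ω = some fun i => some (π i)} : ℝ) ≤
        ∑ ω : Coins p, sortWeight (π.trans x.symm) (itemTarget hN ω.targets) := by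
    rw [← sum_boole, sum_coins, sum_coins]
    refine sum_le_sum fun T _ => ?_
    rw [sum_boole, sum_perms T fun T => sortWeight (π.trans x.symm) (itemTarget hN T)]
    exact card_perms_output_eq_le hN x π T
  refine (div_le_div_of_nonneg_right card_le_sum (Nat.cast_nonneg _)).trans ?_
  have weight_le := sum_sortWeight_le (β := Fin p.B) (π.trans x.symm)
  rw [Fintype.card_fin] at weight_le
  rw [average_coins_itemTarget hB hN, div_le_iff₀ (by positivity), one_div_mul_eq_div]
  exact weight_le

theorem toReal_uniformLaw_apply (π : Equiv.Perm (Fin N)) :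
    (uniformLaw N (some fun i => some (π i))).toReal = 1 / N.factorial := by
  have arrangement_eq_iff (σ : Equiv.Perm (Fin N)) :
      (some fun i => some (σ i)) = (some fun i => some (π i)) ↔ σ = π := by
    simp [funext_iff, Equiv.ext_iff]
  rw [uniformLaw, toReal_map_uniformOfFintype_apply, Fintype.card_perm, Fintype.card_fin]
  simp only [arrangement_eq_iff, filter_eq', mem_univ, if_true, card_singleton, Nat.cast_one]

open scoped Classical in
theorem statDist_outputLaw_le_card_not_succeeds (hB : 0 < p.B) (hN : N ≤ p.B * p.D)
    (x : Equiv.Perm (Fin N)) :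
    statDist (outputLaw p x) (uniformLaw N) ≤
      (#{ω : Coins p | ¬Succeeds hN x ω} : ℝ) / Fintype.card (Coins p) := by
  refine statDist_map_uniformOfFintype_le _ _ _ fun a => ?_
  by_cases h : ∃ π : Equiv.Perm (Fin N), a = some fun i => some (π i)
  · obtain ⟨π, rfl⟩ := h
    rw [toReal_uniformLaw_apply]
    exact card_coins_output_eq_le hB hN x π
  · have filter_eq_empty : ({ω : Coins p | Succeeds hN x ω ∧ output x ω = a} : Finset _) = ∅ := by
      refine filter_eq_empty_iff.2 fun ω _ ⟨succeeds, output_eq⟩ => h ?_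
      exact output_eq ▸ succeeds.exists_output_eq
    rw [filter_eq_empty, card_empty, Nat.cast_zero, zero_div]
    exact ENNReal.toReal_nonneg

open scoped Classical in
theorem statDist_outputLaw_le (hB : 0 < p.B) (hN : N ≤ p.B * p.D) (κ : ℕ)
    (x : Equiv.Perm (Fin N)) :
    statDist (outputLaw p x) (uniformLaw N) ≤
      (#{v : Fin N → Fin p.B | ¬Good p N κ v} : ℝ) / (p.B : ℝ) ^ N := by
  refine (statDist_outputLaw_le_card_not_succeeds hB hN x).trans ?_
  rw [← sum_boole, ← sum_boole, ← average_coins_itemTarget hB hN]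
  refine div_le_div_of_nonneg_right (sum_le_sum fun ω _ => ?_) (Nat.cast_nonneg _)
  by_cases good : Good p N κ (itemTarget hN ω.targets)
  · rw [if_neg (not_not.2 (succeeds_of_good hN x ω good)), if_neg (not_not.2 good)]
  · rw [if_pos good]
    exact (ite_le_sup _ _ _).trans_eq (sup_of_le_left zero_le_one)

end Distance

/-! ### Concentration of the loads -/

section Concentration

open Finset

section Chernoff

variable {ι β : Type*} [Fintype ι] [DecidableEq ι] [Fintype β] [DecidableEq β]

theorem sum_exp_mul_card_filter [Nonempty β] (A : Finset ι) (J : Finset β) (θ : ℝ) :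
    ∑ v : ι → β, Real.exp (θ * #{k ∈ A | v k ∈ J}) =
      (Fintype.card β : ℝ) ^ Fintype.card ι *
        (1 + (#J : ℝ) / Fintype.card β * (Real.exp θ - 1)) ^ #A := by
  have exp_eq_prod (v : ι → β) : Real.exp (θ * #{k ∈ A | v k ∈ J}) =
      ∏ k, if k ∈ A ∧ v k ∈ J then Real.exp θ else 1 := by
    rw [← prod_filter, prod_const, ← Real.exp_nat_mul, mul_comm]
    congr 4
    ext k
    simp
  have sum_eq (k : ι) : (∑ j : β, if k ∈ A ∧ j ∈ J then Real.exp θ else 1) =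
      Fintype.card β * if k ∈ A then 1 + (#J : ℝ) / Fintype.card β * (Real.exp θ - 1) else 1 := by
    by_cases hk : k ∈ A
    · have ite_eq (j : β) : (if k ∈ A ∧ j ∈ J then Real.exp θ else 1) =
          1 + if j ∈ J then Real.exp θ - 1 else 0 := by
        by_cases hj : j ∈ J <;> simp [hk, hj]
      rw [sum_congr rfl fun j _ => ite_eq j, sum_add_distrib, if_pos hk, sum_ite_mem, univ_inter]
      simp only [sum_const, card_univ, nsmul_eq_mul, mul_one]
      field_simp
    · simp [hk]
  rw [sum_congr rfl fun v _ => exp_eq_prod v,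
    ← Fintype.prod_sum fun k j => if k ∈ A ∧ j ∈ J then Real.exp θ else 1,
    prod_congr rfl fun k _ => sum_eq k, prod_mul_distrib, prod_const, card_univ, prod_ite_mem,
    univ_inter, prod_const]

theorem sum_exp_mul_card_filter_le [Nonempty β] (A : Finset ι) (J : Finset β) {θ : ℝ}
    (hθ₀ : 0 ≤ θ) (hθ₁ : θ ≤ 1) :
    ∑ v : ι → β, Real.exp (θ * #{k ∈ A | v k ∈ J}) ≤ (Fintype.card β : ℝ) ^ Fintype.card ι *
      Real.exp (#A * (#J / Fintype.card β) * (θ + θ ^ 2)) := by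
  have exp_sub_one_le : Real.exp θ - 1 ≤ θ + θ ^ 2 := by
    have abs_le_sq := Real.abs_exp_sub_one_sub_id_le ((abs_of_nonneg hθ₀).trans_le hθ₁)
    linarith [(abs_le.1 abs_le_sq).2]
  have exp_sub_one_nonneg : 0 ≤ Real.exp θ - 1 := sub_nonneg.2 (Real.one_le_exp hθ₀)
  rw [sum_exp_mul_card_filter]
  refine mul_le_mul_of_nonneg_left ?_ (by positivity)
  calc (1 + (#J : ℝ) / Fintype.card β * (Real.exp θ - 1)) ^ #A
      ≤ (1 + (#J : ℝ) / Fintype.card β * (θ + θ ^ 2)) ^ #A := by gcongr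
    _ ≤ Real.exp ((#J : ℝ) / Fintype.card β * (θ + θ ^ 2)) ^ #A := by
        gcongr
        rw [add_comm]
        exact Real.add_one_le_exp _
    _ = Real.exp (#A * (#J / Fintype.card β) * (θ + θ ^ 2)) := by
        rw [← Real.exp_nat_mul, mul_assoc]

theorem card_le_card_filter_mem_le [Nonempty β] (A : Finset ι) (J : Finset β) {θ : ℝ}
    (hθ₀ : 0 ≤ θ) (hθ₁ : θ ≤ 1) (c : ℝ) :
    (#{v : ι → β | c ≤ #{k ∈ A | v k ∈ J}} : ℝ) ≤ (Fintype.card β : ℝ) ^ Fintype.card ι *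
      Real.exp (#A * (#J / Fintype.card β) * (θ + θ ^ 2) - θ * c) := by
  rw [sub_eq_add_neg, Real.exp_add, ← mul_assoc]
  refine le_trans ?_ (mul_le_mul_of_nonneg_right (sum_exp_mul_card_filter_le A J hθ₀ hθ₁)
    (Real.exp_pos _).le)
  rw [sum_mul, ← sum_boole]
  refine sum_le_sum fun v _ => ?_
  rw [← Real.exp_add, ← sub_eq_add_neg, ← mul_sub]
  split_ifs with h
  · exact Real.one_le_exp (mul_nonneg hθ₀ (sub_nonneg.2 h))
  · exact (Real.exp_pos _).le

theorem card_mean_add_le_card_filter_mem_le [Nonempty β] (J : Finset β) {δ c : ℝ} (hδ₀ : 0 ≤ δ)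
    (hδ : δ ≤ 2 * Fintype.card ι) (hc : Fintype.card ι * (#J / Fintype.card β) + δ ≤ c) :
    (#{v : ι → β | c ≤ #{k | v k ∈ J}} : ℝ) ≤ (Fintype.card β : ℝ) ^ Fintype.card ι *
      Real.exp (-(δ ^ 2 / (4 * Fintype.card ι))) := by
  set n : ℝ := (Fintype.card ι : ℝ) with n_def
  have n_nonneg : 0 ≤ n := Nat.cast_nonneg _
  have mean_le : n * (#J / Fintype.card β) ≤ n := by
    refine mul_le_of_le_one_right n_nonneg (div_le_one_of_le₀ ?_ (Nat.cast_nonneg _))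
    exact_mod_cast card_le_univ J
  have hθ₁ : δ / (2 * n) ≤ 1 := div_le_one_of_le₀ hδ (by positivity)
  refine (card_le_card_filter_mem_le univ J (by positivity : 0 ≤ δ / (2 * n)) hθ₁ c).trans ?_
  refine mul_le_mul_of_nonneg_left (Real.exp_le_exp.2 ?_) (by positivity)
  rw [card_univ, ← n_def]
  calc n * (#J / Fintype.card β) * (δ / (2 * n) + (δ / (2 * n)) ^ 2) - δ / (2 * n) * c
      ≤ n * (δ / (2 * n)) ^ 2 - δ / (2 * n) * δ := by
        nlinarith [mul_le_mul_of_nonneg_right mean_le (sq_nonneg (δ / (2 * n))),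
          mul_le_mul_of_nonneg_left hc (by positivity : 0 ≤ δ / (2 * n))]
    _ = -(δ ^ 2 / (4 * n)) := by
        rcases n_nonneg.eq_or_lt with n_eq | n_pos
        · simp [← n_eq]
        · field_simp
          ring

end Chernoff

theorem card_exists_le {ι Ω : Type*} [Fintype ι] [Fintype Ω] (E : ι → Ω → Prop)
    [∀ i, DecidablePred (E i)] [DecidablePred fun v => ∃ i, E i v] {y : ℝ}
    (h : ∀ i, (#{v | E i v} : ℝ) ≤ y) : (#{v | ∃ i, E i v} : ℝ) ≤ Fintype.card ι * y := by
  classical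
  have subset_biUnion : ({v | ∃ i, E i v} : Finset Ω) ⊆ univ.biUnion fun i => {v | E i v} := by
    intro v hv
    simpa using hv
  calc (#{v | ∃ i, E i v} : ℝ) ≤ ∑ i, (#{v | E i v} : ℝ) := by
        exact_mod_cast (card_le_card subset_biUnion).trans card_biUnion_le
    _ ≤ ∑ _i : ι, y := sum_le_sum fun i _ => h i
    _ = Fintype.card ι * y := by rw [sum_const, card_univ, nsmul_eq_mul]

variable {p : Params} {N κ : ℕ} {θ δ : ℝ}

theorem card_sentTo_gt_le (hB : 0 < p.B) (hθ₀ : 0 ≤ θ) (hθ₁ : θ ≤ 1)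
    (hC : (p.D : ℝ) / p.B * (1 + θ) ≤ p.C) (κ : ℕ) (j : Fin p.B) (a b : ℕ) :
    (#{v : Fin N → Fin p.B |
        (b + 1 - a) * p.C + κ < #(sentTo v j (a * p.D) ((b + 1) * p.D))} : ℝ) ≤
      (p.B : ℝ) ^ N * Real.exp (-(θ * κ)) := by
  have : Nonempty (Fin p.B) := ⟨⟨0, hB⟩⟩
  let slots : Finset (Fin N) := {k | a * p.D ≤ k.val ∧ k.val < (b + 1) * p.D}
  have card_slots_le : (#slots : ℝ) ≤ (b + 1 - a : ℕ) * p.D := by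
    rw [← Nat.cast_mul, Nat.cast_le, Nat.sub_mul, ← Nat.card_Ico]
    refine card_le_card_of_injOn Fin.val (fun k hk => ?_) Fin.val_injective.injOn
    simpa [slots] using hk
  have sentTo_eq (v : Fin N → Fin p.B) :
      sentTo v j (a * p.D) ((b + 1) * p.D) = {k ∈ slots | v k ∈ ({j} : Finset (Fin p.B))} := by
    ext k
    simp [slots, mem_sentTo, and_comm]
  have chernoff := card_le_card_filter_mem_le slots {j} hθ₀ hθ₁ ((b + 1 - a : ℕ) * p.C + κ)
  rw [Fintype.card_fin, Fintype.card_fin, card_singleton, Nat.cast_one] at chernoff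
  refine (Nat.cast_le.2 (card_le_card fun v hv => ?_)).trans (chernoff.trans ?_)
  · rw [mem_filter_univ, sentTo_eq] at hv
    rw [mem_filter_univ]
    exact_mod_cast hv.le
  · refine mul_le_mul_of_nonneg_left (Real.exp_le_exp.2 ?_) (by positivity)
    have mean_le : (#slots : ℝ) * (1 / p.B) * (θ + θ ^ 2) ≤ θ * ((b + 1 - a : ℕ) * p.C) :=
      calc (#slots : ℝ) * (1 / p.B) * (θ + θ ^ 2)
          ≤ ((b + 1 - a : ℕ) * p.D) * (1 / p.B) * (θ + θ ^ 2) := by gcongr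
        _ = θ * ((b + 1 - a : ℕ) * (p.D / p.B * (1 + θ))) := by ring
        _ ≤ θ * ((b + 1 - a : ℕ) * p.C) := by gcongr
    linarith

theorem card_load_gt_le (hD : (N : ℝ) / p.B ≤ p.D) (hδ₀ : 0 ≤ δ) (hδ : δ ≤ 2 * N)
    (hQ : δ ≤ p.Q) {b : ℕ} (hb : b < p.B) :
    (#{v : Fin N → Fin p.B | (b + 1) * p.D + p.Q < #{k | (v k).val < b + 1}} : ℝ) ≤
      (p.B : ℝ) ^ N * Real.exp (-(δ ^ 2 / (4 * N))) := by
  have : Nonempty (Fin p.B) := ⟨⟨b, hb⟩⟩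
  let low : Finset (Fin p.B) := {j | j.val < b + 1}
  have card_low : #low = b + 1 := by rw [Fin.card_filter_val_lt, min_eq_right hb]
  have chernoff := card_mean_add_le_card_filter_mem_le (ι := Fin N) low
    (c := (b + 1) * p.D + p.Q) hδ₀ (by rwa [Fintype.card_fin]) (by
      rw [Fintype.card_fin, Fintype.card_fin, card_low, mul_div_left_comm]
      push_cast
      gcongr)
  rw [Fintype.card_fin, Fintype.card_fin] at chernoff
  refine (Nat.cast_le.2 (card_le_card fun v hv => ?_)).trans chernoff
  rw [mem_filter_univ] at hv ⊢
  simp only [low, mem_filter_univ]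
  exact_mod_cast hv.le

theorem card_load_lt_le (hD : (p.D : ℝ) ≤ N / p.B + 1) (hδ₀ : 0 ≤ δ) (hδ : δ ≤ 2 * N)
    (hNB : δ ≤ N / p.B - p.B) {b : ℕ} (hb : b < p.B) :
    (#{v : Fin N → Fin p.B | #{k | (v k).val < b + 1} < b * p.D} : ℝ) ≤
      (p.B : ℝ) ^ N * Real.exp (-(δ ^ 2 / (4 * N))) := by
  have : Nonempty (Fin p.B) := ⟨⟨b, hb⟩⟩
  let high : Finset (Fin p.B) := {j | ¬j.val < b + 1}
  have card_high : (#high : ℝ) = p.B - (b + 1) := by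
    have card_add := card_filter_add_card_filter_not (s := (univ : Finset (Fin p.B)))
      (fun j => j.val < b + 1)
    rw [Fin.card_filter_val_lt, min_eq_right hb, card_univ, Fintype.card_fin] at card_add
    exact eq_sub_of_add_eq' (by exact_mod_cast card_add)
  have mean_add_le : N * (#high / p.B : ℝ) + δ ≤ N - b * p.D := by
    have hB : (0 : ℝ) < p.B := Nat.cast_pos.2 (Nat.zero_lt_of_lt hb)
    have mean_eq : N * (#high / p.B : ℝ) = N - (b + 1) * (N / p.B) := by
      rw [card_high]
      field_simp
    rw [mean_eq]
    linarith [mul_le_mul_of_nonneg_left hD (Nat.cast_nonneg (α := ℝ) b),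
      (Nat.cast_le.2 hb.le : (b : ℝ) ≤ p.B)]
  have chernoff := card_mean_add_le_card_filter_mem_le (ι := Fin N) high
    (c := N - b * p.D) hδ₀ (by rwa [Fintype.card_fin]) (by
      rwa [Fintype.card_fin, Fintype.card_fin])
  rw [Fintype.card_fin, Fintype.card_fin] at chernoff
  refine (Nat.cast_le.2 (card_le_card fun v hv => ?_)).trans chernoff
  rw [mem_filter_univ] at hv ⊢
  simp only [high, mem_filter_univ]
  have card_add := card_filter_add_card_filter_not (s := (univ : Finset (Fin N)))
    (fun k => (v k).val < b + 1)
  rw [card_univ, Fintype.card_fin] at card_add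
  rw [sub_le_iff_le_add]
  exact_mod_cast (by omega :
    N ≤ #{k | ¬(v k).val < b + 1} + b * p.D)

/-- Conditions on the parameters under which the shuffle of `N` items is unlikely to fail: the
chunks exceed their expected load by the factor `1 + θ`, each part of the stash may hold `κ` items,
and a deviation of `δ` from the expected load of the queue causes neither overflow nor underflow. -/
structure HasSlack (p : Params) (N κ : ℕ) (θ δ : ℝ) : Prop where
  W_eq : p.W = 2
  two_le_B : 2 ≤ p.B
  le_D : (N : ℝ) / p.B ≤ p.D
  D_le : (p.D : ℝ) ≤ N / p.B + 1
  theta_nonneg : 0 ≤ θ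
  theta_le_one : θ ≤ 1
  le_C : (p.D : ℝ) / p.B * (1 + θ) ≤ p.C
  lt_S : p.B * κ < p.S
  le_K : κ ≤ p.K
  delta_nonneg : 0 ≤ δ
  delta_le_Q : δ ≤ p.Q
  delta_le_sub : δ ≤ N / p.B - p.B

theorem HasSlack.good (h : HasSlack p N κ θ δ) {v : Fin N → Fin p.B}
    (stash : ∀ j a b, a ≤ b → b < p.B →
      #(sentTo v j (a * p.D) ((b + 1) * p.D)) ≤ (b + 1 - a) * p.C + κ)
    (load_le : ∀ b < p.B, #{k | (v k).val < b + 1} ≤ (b + 1) * p.D + p.Q)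
    (le_load : ∀ b < p.B, b * p.D ≤ #{k | (v k).val < b + 1}) : Good p N κ v := by
  have min_W_B : min p.W p.B = 2 := by rw [h.W_eq, min_eq_left h.two_le_B]
  refine ⟨⟨stash, h.lt_S, h.le_K⟩, ⟨fun b hb => ?_, fun b hb hbB => ?_⟩⟩
  · have load_le_N : #{k | (v k).val < b + 1} ≤ N :=
      (card_le_univ _).trans_eq (Fintype.card_fin N)
    have mul_D_le : (b + 1) * p.D ≤ (b + 1 - 2) * p.D + 2 * p.D := by
      rw [← add_mul]
      exact Nat.mul_le_mul_right _ (by omega)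
    have := load_le b hb
    rw [min_W_B, h.W_eq]
    omega
  · rw [min_W_B] at hb ⊢
    obtain ⟨b, rfl⟩ : ∃ c, b = c + 1 := ⟨b - 1, by omega⟩
    exact (min_le_left _ _).trans (le_load b (by omega))

theorem HasSlack.exists_of_not_good (h : HasSlack p N κ θ δ) {v : Fin N → Fin p.B}
    (hv : ¬Good p N κ v) :
    (∃ t : Fin p.B × Fin p.B × Fin p.B, (t.2.2 + 1 - t.2.1) * p.C + κ <
      #(sentTo v t.1 (t.2.1 * p.D) ((t.2.2 + 1) * p.D))) ∨
    (∃ b : Fin p.B, (b + 1) * p.D + p.Q < #{k | (v k).val < b + 1}) ∨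
    ∃ b : Fin p.B, #{k | (v k).val < b + 1} < b * p.D := by
  contrapose! hv
  obtain ⟨stash, load_le, le_load⟩ := hv
  exact h.good (fun j a b hab hb => stash (j, ⟨a, hab.trans_lt hb⟩, ⟨b, hb⟩))
    (fun b hb => load_le ⟨b, hb⟩) fun b hb => le_load ⟨b, hb⟩

open scoped Classical in
theorem HasSlack.card_not_good_le (h : HasSlack p N κ θ δ) :
    (#{v : Fin N → Fin p.B | ¬Good p N κ v} : ℝ) / (p.B : ℝ) ^ N ≤
      (p.B : ℝ) ^ 3 * Real.exp (-(θ * κ)) + 2 * p.B * Real.exp (-(δ ^ 2 / (4 * N))) := by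
  have hB : 0 < p.B := zero_lt_two.trans_le h.two_le_B
  have delta_le : δ ≤ 2 * N := by
    have div_le : (N : ℝ) / p.B ≤ N := div_le_self (Nat.cast_nonneg _) (Nat.one_le_cast.2 hB)
    linarith [h.delta_le_sub, Nat.cast_nonneg (α := ℝ) p.B, Nat.cast_nonneg (α := ℝ) N]
  have stash := card_exists_le _ fun t : Fin p.B × Fin p.B × Fin p.B =>
    card_sentTo_gt_le (N := N) hB h.theta_nonneg h.theta_le_one h.le_C κ t.1 t.2.1 t.2.2
  have overflow := card_exists_le _ fun b : Fin p.B =>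
    card_load_gt_le (N := N) h.le_D h.delta_nonneg delta_le h.delta_le_Q b.isLt
  have underflow := card_exists_le _ fun b : Fin p.B =>
    card_load_lt_le (N := N) h.D_le h.delta_nonneg delta_le h.delta_le_sub b.isLt
  rw [Fintype.card_prod, Fintype.card_prod, Fintype.card_fin, Nat.cast_mul, Nat.cast_mul] at stash
  rw [Fintype.card_fin] at overflow underflow
  have card_le := card_le_card (monotone_filter_right (univ : Finset (Fin N → Fin p.B))
    fun v _ (hv : ¬Good p N κ v) => h.exists_of_not_good (v := v) hv)
  rw [filter_or, filter_or] at card_le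
  replace card_le := Nat.cast_le (α := ℝ).2 <|
    card_le.trans <| (card_union_le _ _).trans <| Nat.add_le_add_left (card_union_le _ _) _
  rw [Nat.cast_add, Nat.cast_add] at card_le
  rw [div_le_iff₀ (by positivity)]
  linarith

end Concentration

/-! ### Asymptotics -/

section Asymptotics

/-- The sizes of the parameters of the shuffle of `N` items, written as polynomials in `X` and `Y`
up to rounding. In the application `X = N ^ ε` and `Y = N ^ (1 / 2 - ε)`. -/
structure Sizes (N : ℕ) (p : Params) (ε X Y : ℝ) : Prop where
  natCast_eq : (N : ℝ) = (Y * X) ^ 2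
  sixty_le : 60 ≤ X
  sq_le : X ^ 2 ≤ Y
  eps_pos : 0 < ε
  eps_le : ε ≤ 1 / 10
  one_le : 1 ≤ ε * X
  W_eq : p.W = 2
  le_B : Y ≤ p.B
  B_lt : p.B < Y + 1
  le_D : (N : ℝ) / p.B ≤ p.D
  D_lt : p.D < (N : ℝ) / p.B + 1
  le_C : (1 + ε) * X ^ 2 ≤ p.C
  C_lt : p.C < (1 + ε) * X ^ 2 + 1
  le_S : Y * X ^ 3 ≤ p.S
  S_lt : p.S < Y * X ^ 3 + 1
  le_K : X ^ 3 ≤ p.K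
  K_lt : p.K < X ^ 3 + 1
  le_Q : Y * X ^ 2 ≤ p.Q
  Q_lt : p.Q < Y * X ^ 2 + 1

namespace Sizes

variable {N : ℕ} {p : Params} {ε X Y : ℝ}

theorem le_Y (h : Sizes N p ε X Y) : 3600 ≤ Y := by
  nlinarith [h.sixty_le, h.sq_le]

theorem B_pos (h : Sizes N p ε X Y) : (0 : ℝ) < p.B := by
  linarith [h.le_B, h.le_Y]

theorem le_mul (h : Sizes N p ε X Y) : N ≤ p.B * p.D := by
  have le_D := h.le_D
  rw [div_le_iff₀' h.B_pos] at le_D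
  exact_mod_cast le_D

theorem B_le (h : Sizes N p ε X Y) : (p.B : ℝ) ≤ N := by
  have le_X := h.sixty_le
  have le_Y := h.le_Y
  calc (p.B : ℝ) ≤ Y * X := by nlinarith [h.B_lt]
    _ ≤ (Y * X) ^ 2 := le_self_pow₀ (by nlinarith) two_ne_zero
    _ = N := h.natCast_eq.symm

theorem div_le (h : Sizes N p ε X Y) : (N : ℝ) / p.B ≤ Y * X ^ 2 := by
  have Y_nonneg : 0 ≤ Y := by linarith [h.le_Y]
  rw [div_le_iff₀ h.B_pos, h.natCast_eq]
  calc (Y * X) ^ 2 = Y * X ^ 2 * Y := by ring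
    _ ≤ Y * X ^ 2 * p.B := by gcongr; exact h.le_B

theorem le_div (h : Sizes N p ε X Y) : Y * X ^ 2 / 2 ≤ (N : ℝ) / p.B := by
  have le_Y := h.le_Y
  rw [le_div_iff₀ h.B_pos, h.natCast_eq]
  calc Y * X ^ 2 / 2 * p.B ≤ Y * X ^ 2 / 2 * (2 * Y) := by gcongr; linarith [h.B_lt]
    _ = (Y * X) ^ 2 := by ring

theorem chunk_slack (h : Sizes N p ε X Y) : (p.D : ℝ) / p.B * (1 + ε / 2) ≤ p.C := by
  have eps_pos := h.eps_pos
  have div_le : (p.D : ℝ) / p.B ≤ X ^ 2 + 1 := by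
    rw [div_le_iff₀ h.B_pos]
    calc (p.D : ℝ) ≤ Y * X ^ 2 + 1 := by linarith [h.D_lt, h.div_le]
      _ ≤ (X ^ 2 + 1) * Y := by linarith [h.le_Y]
      _ ≤ (X ^ 2 + 1) * p.B := by gcongr; exact h.le_B
  have le_sq : 60 ≤ ε * X ^ 2 := by nlinarith [h.sixty_le, h.one_le]
  calc (p.D : ℝ) / p.B * (1 + ε / 2) ≤ (X ^ 2 + 1) * (1 + ε / 2) := by gcongr
    _ ≤ (1 + ε) * X ^ 2 := by nlinarith [h.eps_le]
    _ ≤ p.C := h.le_C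

theorem stash_slack (h : Sizes N p ε X Y) : p.B * ⌊X ^ 3 / 2⌋₊ < p.S := by
  have X_pos : 0 < X := by linarith [h.sixty_le]
  have floor_le : (⌊X ^ 3 / 2⌋₊ : ℝ) ≤ X ^ 3 / 2 := Nat.floor_le (by positivity)
  have mul_lt : (p.B : ℝ) * ⌊X ^ 3 / 2⌋₊ < p.S :=
    calc (p.B : ℝ) * ⌊X ^ 3 / 2⌋₊ ≤ p.B * (X ^ 3 / 2) := by gcongr
      _ < 2 * Y * (X ^ 3 / 2) := by gcongr; linarith [h.B_lt, h.le_Y]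
      _ = Y * X ^ 3 := by ring
      _ ≤ p.S := h.le_S
  exact_mod_cast mul_lt

theorem hasSlack (h : Sizes N p ε X Y) :
    HasSlack p N ⌊X ^ 3 / 2⌋₊ (ε / 2) (Y * X ^ 2 / 4) where
  W_eq := h.W_eq
  two_le_B := by
    have two_le : (2 : ℝ) ≤ p.B := by linarith [h.le_B, h.le_Y]
    exact_mod_cast two_le
  le_D := h.le_D
  D_le := h.D_lt.le
  theta_nonneg := by linarith [h.eps_pos]
  theta_le_one := by linarith [h.eps_le]
  le_C := h.chunk_slack
  lt_S := h.stash_slack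
  le_K := by
    have X_cube_nonneg : 0 ≤ X ^ 3 := pow_nonneg (by linarith [h.sixty_le]) 3
    have floor_le : (⌊X ^ 3 / 2⌋₊ : ℝ) ≤ p.K := by
      linarith [h.le_K, Nat.floor_le (div_nonneg X_cube_nonneg zero_le_two)]
    exact_mod_cast floor_le
  delta_nonneg := by
    have Y_nonneg : 0 ≤ Y := by linarith [h.le_Y]
    positivity
  delta_le_Q := by nlinarith [h.le_Q, h.le_Y, sq_nonneg X]
  delta_le_sub := by
    have le_Y := h.le_Y
    have mul_le : Y * 60 ^ 2 ≤ Y * X ^ 2 := by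
      gcongr
      exact h.sixty_le
    linarith [h.le_div, h.B_lt]

theorem statDist_le (h : Sizes N p ε X Y) (x : Equiv.Perm (Fin N)) :
    statDist (outputLaw p x) (uniformLaw N) ≤ (N : ℝ) ^ 4 * Real.exp (-(X ^ 2 / 64)) := by
  have hB : 0 < p.B := zero_lt_two.trans_le h.hasSlack.two_le_B
  refine (statDist_outputLaw_le hB h.le_mul _ x).trans (h.hasSlack.card_not_good_le.trans ?_)
  have le_X := h.sixty_le
  have le_Y := h.le_Y
  have eps_pos := h.eps_pos
  have stash_exponent : X ^ 2 / 64 ≤ ε / 2 * ⌊X ^ 3 / 2⌋₊ := by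
    have sq_le : X ^ 2 ≤ ε * X ^ 3 := by nlinarith [h.one_le, sq_nonneg X]
    have le_floor : X ^ 3 / 2 - 1 ≤ (⌊X ^ 3 / 2⌋₊ : ℝ) := (Nat.sub_one_lt_floor _).le
    nlinarith [mul_le_mul_of_nonneg_left le_floor (half_pos eps_pos).le, h.eps_le]
  have queue_exponent : (Y * X ^ 2 / 4) ^ 2 / (4 * N) = X ^ 2 / 64 := by
    rw [h.natCast_eq]
    field_simp
    norm_num
  have one_le_N : (1 : ℝ) ≤ N := (Nat.one_le_cast.2 hB).trans h.B_le
  rw [queue_exponent]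
  calc (p.B : ℝ) ^ 3 * Real.exp (-(ε / 2 * ⌊X ^ 3 / 2⌋₊)) + 2 * p.B * Real.exp (-(X ^ 2 / 64))
      ≤ (N : ℝ) ^ 3 * Real.exp (-(X ^ 2 / 64)) + 2 * N ^ 3 * Real.exp (-(X ^ 2 / 64)) := by
        gcongr
        · exact_mod_cast h.B_le
        · exact h.B_le.trans (le_self_pow₀ one_le_N three_ne_zero)
    _ = 3 * N ^ 3 * Real.exp (-(X ^ 2 / 64)) := by ring
    _ ≤ N * N ^ 3 * Real.exp (-(X ^ 2 / 64)) := by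
        gcongr
        linarith [h.B_le, h.le_B]
    _ = (N : ℝ) ^ 4 * Real.exp (-(X ^ 2 / 64)) := by ring

theorem memBound_le (h : Sizes N p ε X Y) : (memBound p : ℝ) ≤ Y * X ^ 4 := by
  have le_X := h.sixty_le
  have le_Y := h.le_Y
  have B_le : (p.B : ℝ) ≤ 2 * Y := by linarith [h.B_lt]
  have C_le : (p.C : ℝ) ≤ X ^ 3 := by nlinarith [h.C_lt, h.eps_le, sq_nonneg X]
  have one_le_cube : 1 ≤ X ^ 3 := one_le_pow₀ (by linarith)
  have K_le : (p.K : ℝ) ≤ 2 * X ^ 3 := by linarith [h.K_lt]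
  have sq_le_cube : Y * X ^ 2 ≤ Y * X ^ 3 := by
    gcongr
    · linarith
    · norm_num
  have Y_le : Y ≤ Y * X ^ 3 := le_mul_of_one_le_right (by linarith) one_le_cube
  have cube_le : X ^ 3 ≤ Y * X ^ 3 := le_mul_of_one_le_left (by linarith) (by linarith)
  have BC_le : (p.B * p.C : ℝ) ≤ 2 * (Y * X ^ 3) :=
    calc (p.B * p.C : ℝ) ≤ 2 * Y * X ^ 3 := by gcongr
      _ = 2 * (Y * X ^ 3) := by ring
  have BK_le : (p.B * p.K : ℝ) ≤ 4 * (Y * X ^ 3) :=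
    calc (p.B * p.K : ℝ) ≤ 2 * Y * (2 * X ^ 3) := by gcongr
      _ = 4 * (Y * X ^ 3) := by ring
  have memBound_eq : (memBound p : ℝ) =
      p.S + 2 * p.B + 2 * (p.B * p.C) + p.B * p.K + p.K + 3 * p.D + p.Q + 7 := by
    simp only [memBound, Params.midSize, h.W_eq]
    push_cast
    ring
  calc (memBound p : ℝ) ≤ 60 * (Y * X ^ 3) := by
        linarith [h.S_lt, h.D_lt, h.div_le, h.Q_lt]
    _ ≤ X * (Y * X ^ 3) := by gcongr
    _ = Y * X ^ 4 := by ring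

end Sizes

/-- What the estimates need of `N` and `ε`; for admissible `ε` it holds eventually. -/
structure Large (N : ℕ) (ε : ℝ) : Prop where
  le_log : 60 ≤ Real.log N
  eps_pos : 0 < ε
  eps_le : ε ≤ 1 / 10
  log_le : Real.log N ≤ (N : ℝ) ^ ε
  one_le : 1 ≤ ε * (N : ℝ) ^ ε

theorem rpow_eq_rpow_mul_pow {x a b c : ℝ} (hx : 0 < x) (k : ℕ) (hc : c = a + b * k) :
    x ^ c = x ^ a * (x ^ b) ^ k := by
  rw [← Real.rpow_mul_natCast hx.le, ← Real.rpow_add hx, hc]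

namespace Large

variable {N : ℕ} {ε : ℝ}

theorem one_lt (h : Large N ε) : (1 : ℝ) < N := by
  linarith [h.le_log, Real.log_le_self (Nat.cast_nonneg (α := ℝ) N)]

theorem sizes (h : Large N ε) :
    Sizes N (params N ε) ε ((N : ℝ) ^ ε) ((N : ℝ) ^ (1 / 2 - ε)) := by
  have N_pos : (0 : ℝ) < N := zero_lt_one.trans h.one_lt
  have eps_pos := h.eps_pos
  have C_eq : (N : ℝ) ^ (2 * ε) = ((N : ℝ) ^ ε) ^ 2 := by
    rw [← Real.rpow_mul_natCast N_pos.le, mul_comm, Nat.cast_ofNat]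
  have K_eq : (N : ℝ) ^ (3 * ε) = ((N : ℝ) ^ ε) ^ 3 := by
    rw [← Real.rpow_mul_natCast N_pos.le, mul_comm, Nat.cast_ofNat]
  have S_eq : (N : ℝ) ^ (1 / 2 + 2 * ε) = (N : ℝ) ^ (1 / 2 - ε) * ((N : ℝ) ^ ε) ^ 3 :=
    rpow_eq_rpow_mul_pow N_pos 3 (by push_cast; ring)
  have Q_eq : (N : ℝ) ^ (1 / 2 + ε) = (N : ℝ) ^ (1 / 2 - ε) * ((N : ℝ) ^ ε) ^ 2 :=
    rpow_eq_rpow_mul_pow N_pos 2 (by push_cast; ring)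
  exact {
    natCast_eq := by
      rw [← Real.rpow_add N_pos, sub_add_cancel, ← Real.sqrt_eq_rpow, Real.sq_sqrt N_pos.le]
    sixty_le := h.le_log.trans h.log_le
    sq_le := by
      rw [← C_eq]
      exact Real.rpow_le_rpow_of_exponent_le h.one_lt.le (by linarith [h.eps_le])
    eps_pos := h.eps_pos
    eps_le := h.eps_le
    one_le := h.one_le
    W_eq := rfl
    le_B := Nat.le_ceil _
    B_lt := Nat.ceil_lt_add_one (by positivity)
    le_D := Nat.le_ceil _
    D_lt := Nat.ceil_lt_add_one (by positivity)
    le_C := C_eq ▸ Nat.le_ceil _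
    C_lt := C_eq ▸ Nat.ceil_lt_add_one (by positivity)
    le_S := S_eq ▸ Nat.le_ceil _
    S_lt := S_eq ▸ Nat.ceil_lt_add_one (by positivity)
    le_K := K_eq ▸ Nat.le_ceil _
    K_lt := K_eq ▸ Nat.ceil_lt_add_one (by positivity)
    le_Q := Q_eq ▸ Nat.le_ceil _
    Q_lt := Q_eq ▸ Nat.ceil_lt_add_one (by positivity) }

theorem statDist_le (h : Large N ε) (x : Equiv.Perm (Fin N)) :
    statDist (outputLaw (params N ε) x) (uniformLaw N) ≤ (N : ℝ) ^ (-(Real.log N / 64 - 4)) := by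
  have N_pos : (0 : ℝ) < N := zero_lt_one.trans h.one_lt
  have log_sq_le : Real.log N ^ 2 ≤ ((N : ℝ) ^ ε) ^ 2 :=
    pow_le_pow_left₀ (by linarith [h.le_log]) h.log_le 2
  calc statDist (outputLaw (params N ε) x) (uniformLaw N)
      ≤ (N : ℝ) ^ 4 * Real.exp (-(((N : ℝ) ^ ε) ^ 2 / 64)) := h.sizes.statDist_le x
    _ ≤ (N : ℝ) ^ 4 * Real.exp (-(Real.log N ^ 2 / 64)) := by
        gcongr
    _ = (N : ℝ) ^ (-(Real.log N / 64 - 4)) := by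
        rw [← Real.rpow_natCast, Real.rpow_def_of_pos N_pos, Real.rpow_def_of_pos N_pos,
          ← Real.exp_add]
        congr 1
        push_cast
        ring

theorem privateMemory_mem (h : Large N ε) : (privateMemory (params N ε) N : ℝ) ∈
    Set.Icc ((N : ℝ) ^ (1 / 2 + -ε)) ((N : ℝ) ^ (1 / 2 + 3 * ε)) := by
  have N_pos : (0 : ℝ) < N := zero_lt_one.trans h.one_lt
  refine ⟨?_, ?_⟩
  · rw [← sub_eq_add_neg]
    exact h.sizes.le_B.trans (Nat.cast_le.2 (le_privateMemory _ N))
  · rw [rpow_eq_rpow_mul_pow (a := 1 / 2 - ε) (b := ε) N_pos 4 (by push_cast; ring)]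
    exact (Nat.cast_le.2 (privateMemory_le _ N)).trans h.sizes.memBound_le

end Large

theorem tendsto_log_natCast : Tendsto (fun N : ℕ => Real.log N) atTop atTop :=
  Real.tendsto_log_atTop.comp tendsto_natCast_atTop_atTop

theorem Admissible.eventually_large {ε : ℕ → ℝ} (h : Admissible ε) :
    ∀ᶠ N in atTop, Large N (ε N) := by
  obtain ⟨eps_pos, eps_tendsto, isLittleO⟩ := h
  have le_loglog : ∀ᶠ N : ℕ in atTop, 1 ≤ Real.log (Real.log N) :=
    (Real.tendsto_log_atTop.comp tendsto_log_natCast).eventually_ge_atTop 1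
  filter_upwards [eps_pos, eps_tendsto.eventually (ge_mem_nhds (by norm_num : (0 : ℝ) < 1 / 10)),
    isLittleO.def one_pos, tendsto_log_natCast.eventually_ge_atTop 60, le_loglog]
    with N eps_pos eps_le div_le le_log le_loglog
  have log_pos : 0 < Real.log N := by linarith
  have N_pos : (0 : ℝ) < N :=
    log_pos.trans_le (Real.log_le_self (Nat.cast_nonneg _))
  rw [one_mul, Real.norm_of_nonneg eps_pos.le, Real.norm_of_nonneg (by positivity),
    div_le_iff₀' log_pos] at div_le
  have log_le : Real.log N ≤ (N : ℝ) ^ ε N := by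
    rw [Real.rpow_def_of_pos N_pos]
    exact (Real.exp_log log_pos).symm.trans_le (Real.exp_le_exp.2 div_le)
  exact ⟨le_log, eps_pos, eps_le, log_le, (le_loglog.trans div_le).trans <| by
    rw [mul_comm]
    gcongr⟩

theorem isLittleO_sqrt_self {f : ℕ → ℝ} (hf : Tendsto f atTop (𝓝 0))
    (hf₀ : ∀ᶠ N in atTop, 0 ≤ f N) : f =o[atTop] fun N => √(f N) := by
  have sqrt_tendsto : Tendsto (fun N => √(f N)) atTop (𝓝 0) := by
    simpa only [Real.sqrt_zero] using hf.sqrt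
  have mul_isLittleO := ((isLittleO_one_iff ℝ).2 sqrt_tendsto).mul_isBigO
    (isBigO_refl (fun N => √(f N)) atTop)
  refine mul_isLittleO.congr' ?_ (Eventually.of_forall fun N => one_mul _)
  filter_upwards [hf₀] with N hN
  exact Real.mul_self_sqrt hN

theorem exists_admissible : ∃ ε : ℕ → ℝ, Admissible ε := by
  have ratio_tendsto : Tendsto (fun N : ℕ => Real.log (Real.log N) / Real.log N) atTop (𝓝 0) :=
    Real.isLittleO_log_id_atTop.tendsto_div_nhds_zero.comp tendsto_log_natCast
  have ratio_pos : ∀ᶠ N : ℕ in atTop, 0 < Real.log (Real.log N) / Real.log N := by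
    filter_upwards [tendsto_log_natCast.eventually_gt_atTop 1] with N one_lt_log
    exact div_pos (Real.log_pos one_lt_log) (zero_lt_one.trans one_lt_log)
  refine ⟨fun N => √(Real.log (Real.log N) / Real.log N),
    ratio_pos.mono fun N => Real.sqrt_pos.2, ?_,
    isLittleO_sqrt_self ratio_tendsto (ratio_pos.mono fun N => le_of_lt)⟩
  simpa only [Real.sqrt_zero] using ratio_tendsto.sqrt

theorem exists_tendsto_eq_rpow {c : ℝ} {f l u : ℕ → ℝ} (hl : Tendsto l atTop (𝓝 0))
    (hu : Tendsto u atTop (𝓝 0))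
    (h : ∀ᶠ N : ℕ in atTop, f N ∈ Set.Icc ((N : ℝ) ^ (c + l N)) ((N : ℝ) ^ (c + u N))) :
    ∃ η : ℕ → ℝ, Tendsto η atTop (𝓝 0) ∧ ∀ᶠ N : ℕ in atTop, f N = (N : ℝ) ^ (c + η N) := by
  have one_lt : ∀ᶠ N : ℕ in atTop, (1 : ℝ) < N :=
    tendsto_natCast_atTop_atTop.eventually_gt_atTop 1
  have pos_of_mem {N : ℕ} {a b y : ℝ} (hN : (1 : ℝ) < N)
      (hy : y ∈ Set.Icc ((N : ℝ) ^ a) ((N : ℝ) ^ b)) : 0 < y :=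
    (Real.rpow_pos_of_pos (zero_lt_one.trans hN) a).trans_le hy.1
  refine ⟨fun N => Real.logb N (f N) - c,
    tendsto_of_tendsto_of_tendsto_of_le_of_le' hl hu ?_ ?_, ?_⟩
  · filter_upwards [h, one_lt] with N hN one_lt
    rw [le_sub_iff_add_le', Real.le_logb_iff_rpow_le one_lt (pos_of_mem one_lt hN)]
    exact hN.1
  · filter_upwards [h, one_lt] with N hN one_lt
    rw [sub_le_iff_le_add', Real.logb_le_iff_le_rpow one_lt (pos_of_mem one_lt hN)]
    exact hN.2
  · filter_upwards [h, one_lt] with N hN one_lt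
    rw [add_sub_cancel, Real.rpow_logb (zero_lt_one.trans one_lt) one_lt.ne'
      (pos_of_mem one_lt hN)]

end Asymptotics

end StashShuffle

theorem mainTheorem2 :
    (∃ ε : ℕ → ℝ, StashShuffle.Admissible ε) ∧
    ∀ ε : ℕ → ℝ, StashShuffle.Admissible ε →
      -- the shuffle is oblivious
      (∀ N : ℕ, StashShuffle.Oblivious (StashShuffle.params N (ε N)) N) ∧
      -- private memory `N ^ (1/2 + o(1))`
      (∃ η : ℕ → ℝ, Tendsto η atTop (𝓝 0) ∧
        ∀ᶠ N : ℕ in atTop,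
          (StashShuffle.privateMemory (StashShuffle.params N (ε N)) N : ℝ) =
            (N : ℝ) ^ (1 / 2 + η N)) ∧
      -- distance `N ^ (-ω(1))` from uniform, for every initial arrangement of the items
      (∃ g : ℕ → ℝ, Tendsto g atTop atTop ∧
        ∀ᶠ N : ℕ in atTop, ∀ x : Equiv.Perm (Fin N),
          StashShuffle.statDist (StashShuffle.outputLaw (StashShuffle.params N (ε N)) x)
            (StashShuffle.uniformLaw N) ≤ (N : ℝ) ^ (-g N)) := by
  refine ⟨StashShuffle.exists_admissible, fun ε hε => ⟨fun N => StashShuffle.oblivious _ _,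
    ?memory, fun N => Real.log N / 64 - 4, ?unbounded, ?distance⟩⟩
  case memory =>
    have neg_tendsto : Tendsto (fun N => -ε N) atTop (𝓝 0) := by
      simpa only [neg_zero] using hε.2.1.neg
    have mul_tendsto : Tendsto (fun N => 3 * ε N) atTop (𝓝 0) := by
      simpa only [mul_zero] using hε.2.1.const_mul 3
    exact StashShuffle.exists_tendsto_eq_rpow neg_tendsto mul_tendsto
      (hε.eventually_large.mono fun N hN => hN.privateMemory_mem)
  case unbounded =>
    exact tendsto_atTop_add_const_right _ _
      (StashShuffle.tendsto_log_natCast.atTop_div_const (by norm_num))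
  case distance =>
    exact hε.eventually_large.mono fun N hN x => hN.statDist_le x
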